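/- **Setting.** A bandit has $K\ge 1$ arms with reward distributions $\nu_1,\dots,\nu_K$ on $\mathbb R$ with finite means $\mu_1,\dots,\mu_K$. In each round $t=1,2,\dots$ an arm $I_t\in\{1,\dots,K\}$ is pulled and a reward $X_t$ is drawn from $\nu_{I_t}$, independently of the past. Put $\Delta_i=\max_j\mu_j-\mu_i$, let $T_i(t)$ be the number of pulls of arm $i$ in rounds $1,\dots,t$, and let the regret be $R_n=n\max_j\mu_j-\mathbb E\big[\sum_{t=1}^nX_t\big]$. **Upper confidence bound.** For reals $y_1,\dots,y_k$ with ordered values $y_{(1)}\le\dots\le y_{(k)}$ let $\mathrm{med}(y)=y_{(k/2)}$ for even $k$ and $y_{(\lfloor k/2\rfloor+1)}$ for odd $k$. For a sample $D=(x_1,\dots,x_T)$ and $1\le k\le T$ let $\widehat\mu_k(D)$ be the median of the averages of $D$ over the $k$ blocks $B_\ell=\{i\le T: i\equiv \ell \bmod k\}$, $\ell=1,\dots,k$. For an integer $m\ge1$, let $\alpha_{i,j}$ ($i\le T$, $1\le j\le m-1$) be independent uniform signs in $\{-1,1\}$ and $\pi$ an independent uniform permutation of $\{0,\dots,m-1\}$.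 For $\theta\in\mathbb R$ let $D_0(\theta)=D$, $D_j(\theta)=(\alpha_{i,j}(x_i-\theta)+\theta)_{i\le T}$ for $1\le j\le m-1$, and $S_j(\theta)=\widehat\mu_k(D_j(\theta))-\theta$. Write $S_i\prec_\pi S_j$ if $S_i<S_j$, or $S_i=S_j$ and $\pi(i)<\pi(j)$. Let $R(\theta)=1+\#\{1\le j\le m-1:S_0(\theta)\prec_\pi S_j(\theta)\}$ and $$U(D,1/m,k)=\sup\{\theta\in\mathbb R:R(\theta)\le m-1\}\in[-\infty,\infty].$$ **RMM-UCB policy.** Pull each arm once in rounds $1,\dots,K$. In each round $t>K$ let $p_t=1/\lceil 1+t\log^2 t\rceil$ and $k^{(i)}_t=\lfloor\min\{17\log t,\sqrt{T_i(t-1)}\}\rfloor$, compute $U(\,\cdot\,,p_t,k_t^{(i)})$ for each arm $i$ from its past rewards with fresh signs and a fresh permutation, and pull an arm with the largest value (ties being broken by any fixed rule depending only on $t$ and the set of maximizers). **Theorem.** Write $c(a)=4^{(1+a)/a}\,12^{1/(1+a)}$ for $a\in(0,1]$. There is a function $C(\cdot,\cdot,\cdot)$ of three real variables such that the following holds for every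 bandit as above. Suppose that every $\nu_i$ is symmetric about $\mu_i$ and that for every $i$ there is $a_i\in(0,1]$ with $M_i=\mathbb E_{X\sim\nu_i}|X-\mu_i|^{1+a_i}<\infty$. Let $*$ be an arm with $\mu_*=\max_j\mu_j$, and put $c_i=c(a_i)$ and $C_i=C\big(a_*,a_i,M_*/\Delta_i^{1+a_*}\big)$. Then $\sum_{t\le n}X_t$ is integrable for every $n$, and for every $n\ge1$ the regret of the RMM-UCB policy satisfies $$R_n\le\sum_{i:\Delta_i>0}\Big(\max\Big\{c_i\Big(\frac{M_i}{\Delta_i^{1+a_i}}\Big)^{1/a_i},\,17^2\Big\}\log^2 n+C_i\Big)\Delta_i .$$ In particular $C_i$ does not depend on $n$, on $K$, on $M_i$, or on the distributions beyond the three displayed quantities. Moreover, if $a_i=a$ and $M_i=M>0$ for all $i$, then with $c=c(a)$, for all sufficiently large $n$, $$R_n\le n^{\frac1{1+a}}\,\big(2cK\log^3 n\big)^{\frac a{1+a}}\,M^{\frac1{1+a}} .$$ -/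

import Mathlib

open MeasureTheory ProbabilityTheory Filter

noncomputable section

namespace RMMUCB

/-! ### Median-of-means -/

/-- The empirical median of `x 0, …, x (k-1)`: in the ordered sample `x_(1) ≤ … ≤ x_(k)` it is
`x_(k/2)` if `k` is even and `x_(⌊k/2⌋+1)` if `k` is odd. Both are the entry in (zero-based)
position `(k-1)/2`. (Only `0 < k` matters.) -/
def empMedian {k : ℕ} (x : Fin k → ℝ) : ℝ :=
  if h : 0 < k then x (Tuple.sort x ⟨(k - 1) / 2, by omega⟩) else 0

/-- The `ℓ`-th of the `k` blocks of the (zero-based) indices `0, …, n-1`: `ℓ, ℓ + k, ℓ + 2k, …`. -/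
def block (n k ℓ : ℕ) : Finset ℕ := (Finset.range n).filter fun i => i % k = ℓ

/-- The median-of-means estimate with `k` blocks, of the sample `x 0, …, x (n-1)`. -/
def medianOfMeans (n k : ℕ) (x : ℕ → ℝ) : ℝ :=
  empMedian fun ℓ : Fin k => (∑ i ∈ block n k ℓ, x i) / ((block n k ℓ).card : ℝ)

/-! ### One-sided resampled median-of-means (RMM) and its upper confidence bound -/

/-- The `j`-th sample for the parameter `θ`: the original one for `j = 0`, and the alternative
sample `α i j * (x i - θ) + θ` for `j ≠ 0`. -/
def altSample (x : ℕ → ℝ) (α : ℕ → ℕ → ℝ) (θ : ℝ) (j : ℕ) : ℕ → ℝ :=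
  fun i => if j = 0 then x i else α i j * (x i - θ) + θ

/-- The reference variable `S_j(θ)`. -/
def refVar (n k : ℕ) (x : ℕ → ℝ) (α : ℕ → ℕ → ℝ) (θ : ℝ) (j : ℕ) : ℝ :=
  medianOfMeans n k (altSample x α θ j) - θ

/-- The order `S_i(θ) ≺_π S_j(θ)`: the strict order of the reals with ties broken by `π`. -/
def Precedes {m : ℕ} (S : ℕ → ℝ) (π : Equiv.Perm (Fin m)) (i j : Fin m) : Prop :=
  S i < S j ∨ (S i = S j ∧ π i < π j)

open Classical in
/-- The rank `R(θ) = 1 + #{1 ≤ j ≤ m - 1 : S_0(θ) ≺_π S_j(θ)}`. -/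
def rank (m : ℕ) [NeZero m] (n k : ℕ) (x : ℕ → ℝ) (α : ℕ → ℕ → ℝ) (π : Equiv.Perm (Fin m))
    (θ : ℝ) : ℕ :=
  1 + (Finset.univ.filter fun j : Fin m => j ≠ 0 ∧ Precedes (refVar n k x α θ) π 0 j).card

/-- The RMM upper confidence bound `U = sup {θ : R(θ) ≤ m - r}` for the significance level `r / m`,
with values in the extended reals. -/
def ucb (r m : ℕ) [NeZero m] (n k : ℕ) (x : ℕ → ℝ) (α : ℕ → ℕ → ℝ) (π : Equiv.Perm (Fin m)) :
    EReal :=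
  sSup ((fun θ : ℝ => (θ : EReal)) '' {θ : ℝ | rank m n k x α π θ ≤ m - r})

/-! ### Sources of randomness -/

/-- The significance level in round `t` is `p_t = 1 / levelDen t`. -/
def levelDen (t : ℕ) : ℕ := ⌈1 + (t : ℝ) * Real.log t ^ 2⌉₊

instance (t : ℕ) : NeZero (levelDen t) :=
  ⟨(Nat.ceil_pos.2 (by positivity)).ne'⟩

instance (m : ℕ) : MeasurableSpace (Equiv.Perm (Fin m)) := ⊤

/-- The random inputs of a run: `reward i s` is the reward obtained when arm `i` is pulled for the
`(s+1)`-st time; `sign t i s j` is the random sign which in round `t`, for arm `i`, multiplies the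
`(s+1)`-st observation of that arm in the `j`-th alternative sample; `perm t i` is the tie-breaking
permutation for arm `i` in round `t`. Signs and permutations are generated anew in each round. -/
inductive Source (K : ℕ) : Type
  | reward (i : Fin K) (s : ℕ)
  | sign (t : ℕ) (i : Fin K) (s j : ℕ)
  | perm (t : ℕ) (i : Fin K)

/-- Where the random inputs take their values. -/
def Source.Value {K : ℕ} : Source K → Type
  | .reward _ _ => ℝ
  | .sign _ _ _ _ => ℝ
  | .perm t _ => Equiv.Perm (Fin (levelDen t))

instance {K : ℕ} : (c : Source K) → MeasurableSpace c.Value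
  | .reward _ _ => inferInstanceAs (MeasurableSpace ℝ)
  | .sign _ _ _ _ => inferInstanceAs (MeasurableSpace ℝ)
  | .perm t _ => inferInstanceAs (MeasurableSpace (Equiv.Perm (Fin (levelDen t))))

/-- The uniform distribution on `{-1, 1}`. -/
def rademacher : Measure ℝ :=
  (2⁻¹ : ENNReal) • Measure.dirac 1 + (2⁻¹ : ENNReal) • Measure.dirac (-1)

/-- The distributions of the random inputs: rewards of arm `i` follow `ν i`, signs are Rademacher,
and permutations are uniform. -/
def Source.law {K : ℕ} (ν : Fin K → Measure ℝ) : (c : Source K) → Measure c.Value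
  | .reward i _ => ν i
  | .sign _ _ _ _ => rademacher
  | .perm t _ => (PMF.uniformOfFintype (Equiv.Perm (Fin (levelDen t)))).toMeasure

/-- `ξ` is a family of jointly independent random inputs with the prescribed distributions. -/
structure IsRandomInput {Ω : Type*} [MeasurableSpace Ω] (P : Measure Ω) {K : ℕ}
    (ν : Fin K → Measure ℝ) (ξ : (c : Source K) → Ω → c.Value) : Prop where
  measurable : ∀ c, Measurable (ξ c)
  map_eq : ∀ c, P.map (ξ c) = Source.law ν c
  indep : iIndepFun ξ P

/-! ### The RMM-UCB policy -/

section Policy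

variable {K : ℕ} (tie : ℕ → Finset (Fin K) → Fin K) (x : (c : Source K) → c.Value)

/-- The number of blocks `⌊min (17 log t) √T⌋` in round `t`, for an arm with `T` observations. -/
def numBlocks (t T : ℕ) : ℕ := ⌊min (17 * Real.log t) (Real.sqrt T)⌋₊

/-- The upper confidence bound of arm `i` in round `t`, computed from its first `T` rewards at
level `p_t`. -/
def armUCB (t : ℕ) (i : Fin K) (T : ℕ) : EReal :=
  ucb 1 (levelDen t) T (numBlocks t T) (fun s => x (.reward i s))
    (fun s j => x (.sign t i s j)) (x (.perm t i))

open Classical in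
/-- The arm chosen in round `n + 1`, if arm `i` was pulled `T i` times in the rounds `1, …, n`:
each arm is pulled once, and then an arm with the highest upper confidence bound is pulled, with
the rule `tie` selecting one of the maximizers. -/
def nextArm (n : ℕ) (T : Fin K → ℕ) : Fin K :=
  if h : n < K then ⟨n, h⟩
  else tie (n + 1) (Finset.univ.filter fun i =>
    ∀ j, armUCB x (n + 1) j (T j) ≤ armUCB x (n + 1) i (T i))

/-- `pulls tie x n i` is `T_i(n)`, the number of pulls of arm `i` in the rounds `1, …, n`. -/
def pulls : ℕ → Fin K → ℕ
  | 0 => fun _ => 0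
  | n + 1 => fun i => pulls n i + if nextArm tie x n (pulls n) = i then 1 else 0

/-- The arm `I_t` pulled in round `t` (for `t ≥ 1`). -/
def arm (t : ℕ) : Fin K := nextArm tie x (t - 1) (pulls tie x (t - 1))

/-- The reward `X_t` obtained in round `t` (for `t ≥ 1`). -/
def roundReward (t : ℕ) : ℝ :=
  x (.reward (arm tie x t) (pulls tie x (t - 1) (arm tie x t)))

/-- The sum of the rewards obtained in the rounds `1, …, n`. -/
def totalReward (n : ℕ) : ℝ := ∑ t ∈ Finset.Icc 1 n, roundReward tie x t

end Policy

/-! ### Reward distributions and regret -/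

/-- The mean of a distribution on the line. -/
def mean (ν : Measure ℝ) : ℝ := ∫ y, y ∂ν

/-- The absolute central moment of order `1 + a`. -/
def absMoment (ν : Measure ℝ) (a : ℝ) : ℝ := ∫ y, |y - mean ν| ^ (1 + a) ∂ν

/-- The absolute central moment of order `1 + a` is finite. -/
def FiniteAbsMoment (ν : Measure ℝ) (a : ℝ) : Prop :=
  Integrable (fun y => |y - mean ν| ^ (1 + a)) ν

/-- The distribution `ν` is symmetric about `c`. -/
def SymmetricAbout (ν : Measure ℝ) (c : ℝ) : Prop := ν.map (fun y => 2 * c - y) = ν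

/-- The gap `Δ_i = max_j μ_j - μ_i`. -/
def gap {K : ℕ} (ν : Fin K → Measure ℝ) (i : Fin K) : ℝ := (⨆ j, mean (ν j)) - mean (ν i)

/-- The expected regret `R_n = n max_j μ_j - 𝔼[X_1 + … + X_n]` of the RMM-UCB policy. -/
def regret {Ω : Type*} [MeasurableSpace Ω] (P : Measure Ω) {K : ℕ} (ν : Fin K → Measure ℝ)
    (tie : ℕ → Finset (Fin K) → Fin K) (ξ : (c : Source K) → Ω → c.Value) (n : ℕ) : ℝ :=
  n * (⨆ j, mean (ν j)) - ∫ ω, totalReward tie (fun c => ξ c ω) n ∂P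

/-- The constant `4 ^ ((1 + a) / a) * 12 ^ (1 / (1 + a))`. -/
def momentConst (a : ℝ) : ℝ := 4 ^ ((1 + a) / a) * 12 ^ (1 / (1 + a))

end RMMUCB

end

namespace RMMUCB

/-! ### The empirical median -/

/-! The regret equals the sum over arms of `gap ν i` times the expected number of pulls
(`regret_eq_sum`). This is because the event that arm `i` is pulled for the `(s+1)`-st time in round
`t` depends only on inputs other than that very reward. It remains to bound the expected pulls of an
arm with gap `Δ > 0`. At most `N`, of order `D log² n / 4` with `D = sizeConst`, come for free. A
later pull forces either the bound of arm `i` to be at least `μ_i + Δ/2` or the bound of the best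
arm to be below `μ_* - Δ/2` (`lateEvent_subset`). Pull counts are random, so both events are
estimated for each fixed count `s` and summed.

Two facts about the confidence bound carry the estimate. First, it has exact level: at the true
mean, symmetry makes the original sample exchangeable with its sign-flipped copies, so the original
one ranks extreme with probability at most `1 / levelDen t`, whatever the sample size and the number
of blocks (`measure_forall_precedes_le`). Secondly, it is close to the mean for large samples: at
`θ`, a block average of a flipped copy is noise plus `μ + (θ - μ)(1 - sign average)`. If most blocks
have noise at most `η` and sign average at most `1/2`, the copies are separated from the original
sample as soon as `|θ - μ| > 4η`. A truncated Chebyshev inequality makes one block bad with small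
probability, and independence of the blocks makes half of them bad with probability at most `exp
(-k)`, which is at most `t⁻⁸` once `s ≥ D log² t / 4`.

For arm `i` only large `s` occur. For the best arm, the about `D_* log² t / 4` small values of `s`
use the exact level, which is at most `1 / (t log² t)`; this is why the level carries the factor
`log² t`. The probability of a late pull is thus of order `1/t`, the sum over rounds is of order
`log n`, and it is absorbed by the unused part of `D log² n` and a constant.

The second regret bound concerns a fixed bandit and large `n`, so it follows because `log² n` is
negligible against a positive power of `n`. -/

theorem empMedian_le {k : ℕ} (hk : 0 < k) {x : Fin k → ℝ} {y : ℝ}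
    (h : 2 * (Finset.univ.filter fun l => y < x l).card < k) : empMedian x ≤ y := by
  by_contra hlt
  rw [empMedian, dif_pos hk, not_le] at hlt
  set p : Fin k := ⟨(k - 1) / 2, by omega⟩
  have hsub : (Finset.Ici p).image (Tuple.sort x) ⊆ Finset.univ.filter fun l => y < x l := by
    intro l hl
    obtain ⟨q, hq, rfl⟩ := Finset.mem_image.1 hl
    simp only [Finset.mem_filter, Finset.mem_univ, true_and]
    exact hlt.trans_le (Tuple.monotone_sort x (Finset.mem_Ici.1 hq))
  have hcard := Finset.card_le_card hsub
  rw [Finset.card_image_of_injective _ (Tuple.sort x).injective, Fin.card_Ici] at hcard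
  have : (p : ℕ) = (k - 1) / 2 := rfl
  omega

theorem le_empMedian {k : ℕ} (hk : 0 < k) {x : Fin k → ℝ} {y : ℝ}
    (h : 2 * (Finset.univ.filter fun l => x l < y).card < k) : y ≤ empMedian x := by
  by_contra hlt
  rw [empMedian, dif_pos hk, not_le] at hlt
  set p : Fin k := ⟨(k - 1) / 2, by omega⟩
  have hsub : (Finset.Iic p).image (Tuple.sort x) ⊆ Finset.univ.filter fun l => x l < y := by
    intro l hl
    obtain ⟨q, hq, rfl⟩ := Finset.mem_image.1 hl
    simp only [Finset.mem_filter, Finset.mem_univ, true_and]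
    exact (Tuple.monotone_sort x (Finset.mem_Iic.1 hq)).trans_lt hlt
  have hcard := Finset.card_le_card hsub
  rw [Finset.card_image_of_injective _ (Tuple.sort x).injective, Fin.card_Iic] at hcard
  have : (p : ℕ) = (k - 1) / 2 := rfl
  omega

/-- Counting removes the sorting permutation, which jumps with the data. Monotonicity and continuity
of the median, hence its measurability, follow from this form. -/
theorem empMedian_le_iff {k : ℕ} (hk : 0 < k) {x : Fin k → ℝ} {y : ℝ} :
    empMedian x ≤ y ↔ (k - 1) / 2 < (Finset.univ.filter fun l => x l ≤ y).card := by
  constructor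
  · intro h
    rw [empMedian, dif_pos hk] at h
    set p : Fin k := ⟨(k - 1) / 2, by omega⟩
    have hsub : (Finset.Iic p).image (Tuple.sort x) ⊆ Finset.univ.filter fun l => x l ≤ y := by
      intro l hl
      obtain ⟨q, hq, rfl⟩ := Finset.mem_image.1 hl
      simp only [Finset.mem_filter, Finset.mem_univ, true_and]
      exact (Tuple.monotone_sort x (Finset.mem_Iic.1 hq)).trans h
    have hcard := Finset.card_le_card hsub
    rw [Finset.card_image_of_injective _ (Tuple.sort x).injective, Fin.card_Iic] at hcard
    have : (p : ℕ) = (k - 1) / 2 := rfl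
    omega
  · intro h
    by_contra hlt
    rw [empMedian, dif_pos hk, not_le] at hlt
    set p : Fin k := ⟨(k - 1) / 2, by omega⟩
    have hsub : (Finset.univ.filter fun l => x l ≤ y) ⊆ (Finset.Iio p).image (Tuple.sort x) := by
      intro l hl
      simp only [Finset.mem_filter, Finset.mem_univ, true_and] at hl
      refine Finset.mem_image.2 ⟨(Tuple.sort x).symm l, ?_, by simp⟩
      rw [Finset.mem_Iio]
      by_contra hq
      have := Tuple.monotone_sort x (not_lt.1 hq)
      simp only [Function.comp_apply, Equiv.apply_symm_apply] at this
      linarith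
    have hcard := Finset.card_le_card hsub
    rw [Finset.card_image_of_injective _ (Tuple.sort x).injective, Fin.card_Iio] at hcard
    have : (p : ℕ) = (k - 1) / 2 := rfl
    omega

theorem empMedian_le_add {k : ℕ} {x x' : Fin k → ℝ} {ε : ℝ} (hε : 0 ≤ ε)
    (h : ∀ l, x l ≤ x' l + ε) : empMedian x ≤ empMedian x' + ε := by
  rcases Nat.eq_zero_or_pos k with hk | hk
  · simp [empMedian, hk, hε]
  · rw [empMedian_le_iff hk]
    refine ((empMedian_le_iff (x := x') hk).1 le_rfl).trans_le (Finset.card_le_card ?_)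
    intro l
    simp only [Finset.mem_filter, Finset.mem_univ, true_and]
    intro hl
    linarith [h l]

theorem lipschitzWith_empMedian (k : ℕ) : LipschitzWith 1 (empMedian : (Fin k → ℝ) → ℝ) := by
  refine LipschitzWith.of_le_add fun x x' => empMedian_le_add dist_nonneg fun l => ?_
  have := (abs_le.1 ((Real.dist_eq (x l) (x' l)) ▸ dist_le_pi_dist x x' l)).2
  linarith

theorem continuous_empMedian (k : ℕ) : Continuous (empMedian : (Fin k → ℝ) → ℝ) :=
  (lipschitzWith_empMedian k).continuous

theorem medianOfMeans_congr {n k : ℕ} {x y : ℕ → ℝ} (h : ∀ i < n, x i = y i) :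
    medianOfMeans n k x = medianOfMeans n k y := by
  unfold medianOfMeans
  congr 1
  ext l
  congr 1
  refine Finset.sum_congr rfl fun i hi => h i ?_
  simpa [block] using (Finset.mem_filter.1 hi).1

theorem continuous_medianOfMeans (n k : ℕ) : Continuous (medianOfMeans n k) := by
  unfold medianOfMeans
  exact (continuous_empMedian k).comp (by fun_prop)

theorem card_block_ge {n k l : ℕ} (hl : l < k) : n / k ≤ (block n k l).card := by
  have : (Finset.range (n / k)).image (fun q => l + k * q) ⊆ block n k l := by
    intro i hi
    obtain ⟨q, hq, rfl⟩ := Finset.mem_image.1 hi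
    rw [Finset.mem_range] at hq
    simp only [block, Finset.mem_filter, Finset.mem_range]
    refine ⟨?_, by simp [Nat.add_mul_mod_self_left, Nat.mod_eq_of_lt hl]⟩
    calc l + k * q < k + k * q := by omega
      _ = k * (q + 1) := by ring
      _ ≤ k * (n / k) := Nat.mul_le_mul_left _ hq
      _ ≤ n := Nat.mul_div_le _ _
  have h2 := Finset.card_le_card this
  rwa [Finset.card_image_of_injective, Finset.card_range] at h2
  intro q q' h
  have : k * q = k * q' := by simpa using h
  exact Nat.eq_of_mul_eq_mul_left (by omega) this

theorem pairwiseDisjoint_block (n k : ℕ) (s : Set ℕ) : s.PairwiseDisjoint (block n k) := by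
  intro l _ l' _ hne
  refine Finset.disjoint_left.2 fun i hi hi' => hne ?_
  rw [← (Finset.mem_filter.1 hi).2, ← (Finset.mem_filter.1 hi').2]

/-! ### Measurability of the upper confidence bound -/

/-- Existence of a point of a compact set where a continuous function is nonpositive can be tested
on a countable dense subset. -/
theorem measurableSet_exists_mem_Icc_nonpos {X : Type*} [MeasurableSpace X] {g : X → ℝ → ℝ}
    (hm : ∀ θ, Measurable fun x => g x θ) (hc : ∀ x, Continuous (g x)) (a b : ℝ) :
    MeasurableSet {x | ∃ θ ∈ Set.Icc a b, g x θ ≤ 0} := by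
  rcases lt_or_ge b a with hab | hab
  · simp [Set.Icc_eq_empty (not_le.2 hab)]
  have : Nonempty (Set.Icc a b) := ⟨⟨a, le_rfl, hab⟩⟩
  have heq : {x | ∃ θ ∈ Set.Icc a b, g x θ ≤ 0} =
      ⋂ n : ℕ, ⋃ i : ℕ, {x | g x (TopologicalSpace.denseSeq (Set.Icc a b) i) < 1 / ((n : ℝ) + 1)} := by
    ext x
    simp only [Set.mem_ofPred_eq, Set.mem_iInter, Set.mem_iUnion]
    constructor
    · rintro ⟨θ, hθ, hle⟩ n
      have hopen : IsOpen {y : Set.Icc a b | g x y < 1 / ((n : ℝ) + 1)} :=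
        isOpen_lt ((hc x).comp continuous_subtype_val) continuous_const
      have hne : {y : Set.Icc a b | g x y < 1 / ((n : ℝ) + 1)}.Nonempty :=
        ⟨⟨θ, hθ⟩, hle.trans_lt (by positivity)⟩
      obtain ⟨_, hy, i, rfl⟩ :=
        (TopologicalSpace.denseRange_denseSeq (Set.Icc a b)).inter_open_nonempty _ hopen hne
      exact ⟨i, hy⟩
    · intro h
      -- Values below every `1/(n+1)` on the dense sequence only give an infimum at most `0`;
      -- compactness makes it attained.
      obtain ⟨θ, hθ, hmin⟩ := isCompact_Icc.exists_isMinOn ⟨a, le_rfl, hab⟩ (hc x).continuousOn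
      refine ⟨θ, hθ, le_of_forall_pos_lt_add fun ε hε => ?_⟩
      obtain ⟨n, hn⟩ := exists_nat_one_div_lt hε
      obtain ⟨i, hi⟩ := h n
      have := hmin (TopologicalSpace.denseSeq (Set.Icc a b) i).2
      simp only [Set.mem_ofPred_eq] at this
      linarith
  rw [heq]
  exact .iInter fun n => .iUnion fun i => measurableSet_lt (hm _) measurable_const

theorem measurableSet_exists_lt_coe_nonpos {X : Type*} [MeasurableSpace X] {g : X → ℝ → ℝ}
    (hm : ∀ θ, Measurable fun x => g x θ) (hc : ∀ x, Continuous (g x)) (c : EReal) :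
    MeasurableSet {x | ∃ θ : ℝ, c < θ ∧ g x θ ≤ 0} := by
  have heq : {x | ∃ θ : ℝ, c < θ ∧ g x θ ≤ 0} =
      ⋃ p : ℚ, ⋃ q : ℚ, ⋃ _ : c < ((p : ℝ) : EReal),
        {x | ∃ θ ∈ Set.Icc (p : ℝ) q, g x θ ≤ 0} := by
    ext x
    simp only [Set.mem_ofPred_eq, Set.mem_iUnion]
    constructor
    · rintro ⟨θ, hcθ, hle⟩
      obtain ⟨p, hp, hpθ⟩ := EReal.exists_rat_btwn_of_lt hcθ
      obtain ⟨q, hq⟩ := exists_rat_gt θ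
      exact ⟨p, q, hp, θ, ⟨(EReal.coe_lt_coe_iff.1 hpθ).le, hq.le⟩, hle⟩
    · rintro ⟨p, q, hp, θ, hθ, hle⟩
      exact ⟨θ, hp.trans_le (EReal.coe_le_coe_iff.2 hθ.1), hle⟩
  rw [heq]
  exact .iUnion fun p => .iUnion fun q => .iUnion fun _ =>
    measurableSet_exists_mem_Icc_nonpos hm hc p q

theorem measurableSet_exists_lt_coe_neg {X : Type*} [MeasurableSpace X] {g : X → ℝ → ℝ}
    (hm : ∀ θ, Measurable fun x => g x θ) (hc : ∀ x, Continuous (g x)) (c : EReal) :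
    MeasurableSet {x | ∃ θ : ℝ, c < θ ∧ g x θ < 0} := by
  have heq : {x | ∃ θ : ℝ, c < θ ∧ g x θ < 0} =
      ⋃ n : ℕ, {x | ∃ θ : ℝ, c < θ ∧ g x θ + 1 / ((n : ℝ) + 1) ≤ 0} := by
    ext x
    simp only [Set.mem_ofPred_eq, Set.mem_iUnion]
    constructor
    · rintro ⟨θ, hcθ, hlt⟩
      obtain ⟨n, hn⟩ := exists_nat_one_div_lt (neg_pos.2 hlt)
      exact ⟨n, θ, hcθ, by linarith⟩
    · rintro ⟨n, θ, hcθ, hle⟩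
      have : 0 < 1 / ((n : ℝ) + 1) := by positivity
      exact ⟨θ, hcθ, by linarith⟩
  rw [heq]
  exact .iUnion fun n => measurableSet_exists_lt_coe_nonpos (g := fun x θ => g x θ + 1 / ((n : ℝ) + 1))
    (fun θ => (hm θ).add_const _) (fun x => (hc x).add_const _) c

/-- The rank reaches its maximum `m` exactly when index `0` precedes all others, so at level `1/m`
membership in the confidence region has a single witness `j`. -/
theorem rank_le_sub_one_iff {m : ℕ} [NeZero m] {n k : ℕ} {x : ℕ → ℝ} {α : ℕ → ℕ → ℝ}
    {π : Equiv.Perm (Fin m)} {θ : ℝ} :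
    rank m n k x α π θ ≤ m - 1 ↔ ∃ j : Fin m, j ≠ 0 ∧ ¬ Precedes (refVar n k x α θ) π 0 j := by
  classical
  have hm := NeZero.pos m
  have hall : (Finset.univ.filter fun j : Fin m => j ≠ 0).card = m - 1 := by
    rw [Finset.filter_ne', Finset.card_erase_of_mem (Finset.mem_univ _), Finset.card_fin]
  have hsub : (Finset.univ.filter fun j : Fin m => j ≠ 0 ∧ Precedes (refVar n k x α θ) π 0 j) ⊆
      Finset.univ.filter fun j : Fin m => j ≠ 0 :=
    Finset.monotone_filter_right _ fun _ _ h => h.1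
  have hcard := Finset.card_le_card hsub
  have hr : rank m n k x α π θ = 1 + (Finset.univ.filter fun j : Fin m =>
      j ≠ 0 ∧ Precedes (refVar n k x α θ) π 0 j).card := by
    unfold rank
    congr!
  constructor
  · intro h
    by_contra! hno
    have : (Finset.univ.filter fun j : Fin m => j ≠ 0 ∧ Precedes (refVar n k x α θ) π 0 j) =
        Finset.univ.filter fun j : Fin m => j ≠ 0 := by
      ext j
      simp only [Finset.mem_filter, Finset.mem_univ, true_and]
      exact ⟨fun h => h.1, fun h => ⟨h, hno j h⟩⟩
    rw [hr, this] at h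
    omega
  · rintro ⟨j, hj, hnp⟩
    have : (Finset.univ.filter fun j : Fin m => j ≠ 0 ∧ Precedes (refVar n k x α θ) π 0 j).card <
        (Finset.univ.filter fun j : Fin m => j ≠ 0).card := by
      refine Finset.card_lt_card (Finset.ssubset_iff_subset_ne.2 ⟨hsub, fun he => ?_⟩)
      have : j ∈ Finset.univ.filter fun j : Fin m => j ≠ 0 := by simpa using hj
      rw [← he] at this
      exact hnp (Finset.mem_filter.1 this).2.2
    rw [hr]
    omega

theorem lt_ucb_iff {m : ℕ} [NeZero m] {n k : ℕ} {x : ℕ → ℝ} {α : ℕ → ℕ → ℝ}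
    {π : Equiv.Perm (Fin m)} {c : EReal} :
    c < ucb 1 m n k x α π ↔ ∃ j : Fin m, j ≠ 0 ∧ ∃ θ : ℝ, c < θ ∧
      ¬ Precedes (refVar n k x α θ) π 0 j := by
  simp only [ucb, lt_sSup_iff, Set.mem_image, Set.mem_ofPred_eq, rank_le_sub_one_iff]
  constructor
  · rintro ⟨_, ⟨θ, ⟨j, hj, hp⟩, rfl⟩, hc⟩
    exact ⟨j, hj, θ, hc, hp⟩
  · rintro ⟨j, hj, θ, hc, hp⟩
    exact ⟨θ, ⟨θ, ⟨j, hj, hp⟩, rfl⟩, hc⟩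

theorem continuous_refVar (n k : ℕ) (x : ℕ → ℝ) (α : ℕ → ℕ → ℝ) (j : ℕ) :
    Continuous fun θ => refVar n k x α θ j := by
  unfold refVar
  refine ((continuous_medianOfMeans n k).comp ?_).sub continuous_id
  refine continuous_pi fun i => ?_
  unfold altSample
  split_ifs <;> fun_prop

theorem measurable_refVar {X : Type*} [MeasurableSpace X] {n k : ℕ} {x : X → ℕ → ℝ}
    {α : X → ℕ → ℕ → ℝ} (hx : ∀ s, Measurable fun ω => x ω s)
    (hα : ∀ s j, Measurable fun ω => α ω s j) (θ : ℝ) (j : ℕ) :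
    Measurable fun ω => refVar n k (x ω) (α ω) θ j := by
  unfold refVar
  refine ((continuous_medianOfMeans n k).measurable.comp (measurable_pi_lambda _ fun i => ?_)).sub_const _
  unfold altSample
  split_ifs
  · exact hx i
  · exact ((hα i j).mul ((hx i).sub_const _)).add_const _

/-- The supremum runs over uncountably many `θ`, but the reference variables are continuous in `θ`.
For each witness `j`, the permutation only decides whether the comparison of `S_j` with `S_0` is
strict or not, and either case reduces to countably many conditions. -/
theorem measurable_ucb {X : Type*} [MeasurableSpace X] {m : ℕ} [NeZero m] {n k : ℕ}
    {x : X → ℕ → ℝ} {α : X → ℕ → ℕ → ℝ} {π : X → Equiv.Perm (Fin m)}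
    (hx : ∀ s, Measurable fun ω => x ω s) (hα : ∀ s j, Measurable fun ω => α ω s j)
    (hπ : Measurable π) : Measurable fun ω => ucb 1 m n k (x ω) (α ω) (π ω) := by
  refine measurable_of_Ioi fun c => ?_
  have hg (j : Fin m) (θ : ℝ) : Measurable fun ω =>
      refVar n k (x ω) (α ω) θ j - refVar n k (x ω) (α ω) θ 0 :=
    (measurable_refVar hx hα θ j).sub (measurable_refVar hx hα θ 0)
  have hgc (j : Fin m) (ω : X) : Continuous fun θ =>
      refVar n k (x ω) (α ω) θ j - refVar n k (x ω) (α ω) θ 0 :=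
    (continuous_refVar n k _ _ j).sub (continuous_refVar n k _ _ 0)
  have heq : (fun ω => ucb 1 m n k (x ω) (α ω) (π ω)) ⁻¹' Set.Ioi c =
      ⋃ j : Fin m, ⋃ _ : j ≠ 0,
        ((π ⁻¹' {p | p 0 < p j} ∩
            {ω | ∃ θ : ℝ, c < θ ∧ refVar n k (x ω) (α ω) θ j - refVar n k (x ω) (α ω) θ 0 < 0}) ∪
          (π ⁻¹' {p | ¬ p 0 < p j} ∩
            {ω | ∃ θ : ℝ, c < θ ∧ refVar n k (x ω) (α ω) θ j - refVar n k (x ω) (α ω) θ 0 ≤ 0})) := by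
    ext ω
    simp only [Set.mem_preimage, Set.mem_Ioi, lt_ucb_iff, Set.mem_iUnion, Set.mem_union,
      Set.mem_inter_iff, Set.mem_ofPred_eq, exists_prop]
    refine exists_congr fun j => and_congr_right fun hj => ?_
    by_cases hp : π ω 0 < π ω j
    · simp only [hp, true_and, not_true, false_and, or_false]
      refine exists_congr fun θ => and_congr_right fun _ => ?_
      simp only [Precedes, hp, and_true, sub_neg, not_or, not_lt, Fin.val_zero]
      exact ⟨fun h => lt_of_le_of_ne h.1 (Ne.symm h.2), fun h => ⟨h.le, h.ne'⟩⟩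
    · simp only [hp, true_and, not_false_iff, false_and, false_or]
      refine exists_congr fun θ => and_congr_right fun _ => ?_
      simp [Precedes, hp]
  rw [heq]
  refine .iUnion fun j => .iUnion fun _ => .union (.inter (hπ trivial) ?_) (.inter (hπ trivial) ?_)
  · exact measurableSet_exists_lt_coe_neg (g := fun ω θ =>
      refVar n k (x ω) (α ω) θ j - refVar n k (x ω) (α ω) θ 0) (hg j) (hgc j) c
  · exact measurableSet_exists_lt_coe_nonpos (g := fun ω θ =>
      refVar n k (x ω) (α ω) θ j - refVar n k (x ω) (α ω) θ 0) (hg j) (hgc j) c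

theorem refVar_congr {n k : ℕ} {x x' : ℕ → ℝ} {α : ℕ → ℕ → ℝ} (h : ∀ i < n, x i = x' i) (θ : ℝ)
    (j : ℕ) : refVar n k x α θ j = refVar n k x' α θ j := by
  unfold refVar
  rw [medianOfMeans_congr (y := altSample x' α θ j)]
  intro i hi
  simp [altSample, h i hi]

theorem ucb_congr {r m : ℕ} [NeZero m] {n k : ℕ} {x x' : ℕ → ℝ} {α : ℕ → ℕ → ℝ}
    {π : Equiv.Perm (Fin m)} (h : ∀ i < n, x i = x' i) :
    ucb r m n k x α π = ucb r m n k x' α π := by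
  have : ∀ θ, rank m n k x α π θ = rank m n k x' α π θ := fun θ => by
    unfold rank
    rw [funext (refVar_congr h θ)]
  simp only [ucb, this]

/-! ### The policy as a function of the random inputs -/

section Policy

variable {K : ℕ} (tie : ℕ → Finset (Fin K) → Fin K)

theorem measurable_reward (i : Fin K) (s : ℕ) :
    Measurable fun x : (c : Source K) → c.Value => (x (.reward i s) : ℝ) :=
  measurable_pi_apply (Source.reward i s)

theorem measurable_sign (t : ℕ) (i : Fin K) (s j : ℕ) :
    Measurable fun x : (c : Source K) → c.Value => (x (.sign t i s j) : ℝ) :=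
  measurable_pi_apply (Source.sign t i s j)

theorem measurable_perm (t : ℕ) (i : Fin K) :
    Measurable fun x : (c : Source K) → c.Value =>
      (x (.perm t i) : Equiv.Perm (Fin (levelDen t))) :=
  measurable_pi_apply (Source.perm t i)

theorem measurable_armUCB (t : ℕ) (i : Fin K) (T : ℕ) :
    Measurable fun x : (c : Source K) → c.Value => armUCB x t i T :=
  measurable_ucb (fun s => measurable_reward i s) (fun s j => measurable_sign t i s j)
    (measurable_perm t i)

theorem measurable_nextArm (n : ℕ) (T : Fin K → ℕ) :
    Measurable fun x : (c : Source K) → c.Value => nextArm tie x n T := by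
  classical
  unfold nextArm
  split_ifs with h
  · exact measurable_const
  · refine measurable_to_countable' fun i => ?_
    have hset (S : Finset (Fin K)) : MeasurableSet {x : (c : Source K) → c.Value |
        (Finset.univ.filter fun i => ∀ j, armUCB x (n + 1) j (T j) ≤ armUCB x (n + 1) i (T i))
          = S} := by
      have : {x : (c : Source K) → c.Value |
          (Finset.univ.filter fun i => ∀ j, armUCB x (n + 1) j (T j) ≤ armUCB x (n + 1) i (T i))
            = S} = ⋂ i, {x | (∀ j, armUCB x (n + 1) j (T j) ≤ armUCB x (n + 1) i (T i)) ↔ i ∈ S} := by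
        ext x
        simp [Finset.ext_iff]
      rw [this]
      refine .iInter fun i => ?_
      have hi : MeasurableSet {x : (c : Source K) → c.Value |
          ∀ j, armUCB x (n + 1) j (T j) ≤ armUCB x (n + 1) i (T i)} := by
        simp only [Set.ofPred_forall]
        exact .iInter fun j => measurableSet_le (measurable_armUCB _ _ _) (measurable_armUCB _ _ _)
      by_cases hS : i ∈ S
      · simpa [hS] using hi
      · simp only [hS, iff_false]
        exact hi.compl
    have : (fun x : (c : Source K) → c.Value => tie (n + 1) (Finset.univ.filter fun i =>
        ∀ j, armUCB x (n + 1) j (T j) ≤ armUCB x (n + 1) i (T i))) ⁻¹' {i} =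
        ⋃ S : Finset (Fin K), ⋃ _ : tie (n + 1) S = i, {x : (c : Source K) → c.Value |
          (Finset.univ.filter fun i => ∀ j, armUCB x (n + 1) j (T j) ≤ armUCB x (n + 1) i (T i))
            = S} := by
      ext x
      simp
    rw [this]
    exact .iUnion fun S => .iUnion fun _ => hset S

theorem _root_.Measurable.apply_countable {X B C : Type*} [MeasurableSpace X] [MeasurableSpace B]
    [MeasurableSpace C] [Countable B] [MeasurableSingletonClass B] {F : X → B → C}
    (hF : ∀ b, Measurable fun x => F x b) {g : X → B} (hg : Measurable g) :
    Measurable fun x => F x (g x) :=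
  (measurable_from_prod_countable_left (f := fun p : X × B => F p.1 p.2) hF).comp
    (measurable_id.prodMk hg)

theorem measurable_pulls (n : ℕ) :
    Measurable fun x : (c : Source K) → c.Value => pulls tie x n := by
  induction n with
  | zero => exact measurable_const
  | succ n ih =>
    have hnext : Measurable fun x : (c : Source K) → c.Value => nextArm tie x n (pulls tie x n) :=
      Measurable.apply_countable (F := fun x T => nextArm tie x n T)
        (fun T => measurable_nextArm tie n T) ih
    refine measurable_pi_lambda _ fun i => ?_
    exact ((measurable_pi_apply i).comp ih).add
      (Measurable.ite (hnext (measurableSet_singleton i)) measurable_const measurable_const)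

theorem measurable_arm (t : ℕ) :
    Measurable fun x : (c : Source K) → c.Value => arm tie x t :=
  Measurable.apply_countable (F := fun x T => nextArm tie x (t - 1) T)
    (fun T => measurable_nextArm tie (t - 1) T) (measurable_pulls tie (t - 1))

variable {tie}

/-! ### Decisions do not depend on rewards not yet observed. -/

theorem armUCB_congr {x x' : (c : Source K) → c.Value} {i : Fin K} {s : ℕ}
    (h : ∀ c, c ≠ .reward i s → x c = x' c) (t : ℕ) (j : Fin K) {T : ℕ} (hT : j = i → T ≤ s) :
    armUCB x t j T = armUCB x' t j T := by
  unfold armUCB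
  have h1 : (fun r l => (x (.sign t j r l) : ℝ)) = fun r l => (x' (.sign t j r l) : ℝ) := by
    funext r l
    exact h (.sign t j r l) (by simp)
  have h2 : x (.perm t j) = x' (.perm t j) := h (.perm t j) (by simp)
  rw [h1, h2]
  refine ucb_congr fun r hr => h (.reward j r) ?_
  intro heq
  injection heq with h3 h4
  have := hT h3
  omega

theorem nextArm_congr {x x' : (c : Source K) → c.Value} {i : Fin K} {s : ℕ}
    (h : ∀ c, c ≠ .reward i s → x c = x' c) (n : ℕ) {T : Fin K → ℕ} (hT : T i ≤ s) :
    nextArm tie x n T = nextArm tie x' n T := by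
  have : ∀ j, armUCB x (n + 1) j (T j) = armUCB x' (n + 1) j (T j) := fun j =>
    armUCB_congr h _ j (by rintro rfl; exact hT)
  unfold nextArm
  split_ifs
  · rfl
  · refine congrArg (tie (n + 1)) ?_
    ext j
    simp only [this, Finset.mem_filter]

theorem pulls_le_succ (x : (c : Source K) → c.Value) (n : ℕ) (i : Fin K) :
    pulls tie x n i ≤ pulls tie x (n + 1) i := Nat.le_add_right _ _

/-- Counts only grow, so the bound on the count of arm `i` holds in all earlier rounds; the altered
reward has not been seen there. -/
theorem pulls_congr {x x' : (c : Source K) → c.Value} {i : Fin K} {s : ℕ}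
    (h : ∀ c, c ≠ .reward i s → x c = x' c) {n : ℕ} (hn : pulls tie x n i ≤ s) :
    pulls tie x n = pulls tie x' n := by
  induction n with
  | zero => rfl
  | succ n ih =>
    have hle := (pulls_le_succ x n i).trans hn
    have heq := ih hle
    funext j
    simp only [pulls]
    rw [nextArm_congr h n hle, heq]

/-- Before its `(s+1)`-st pull, arm `i` has shown only the rewards with index below `s`. This makes
the event independent of the reward that it reveals. -/
theorem arm_pulls_congr {x x' : (c : Source K) → c.Value} {i : Fin K} {s : ℕ}
    (h : ∀ c, c ≠ .reward i s → x c = x' c) (t : ℕ) :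
    (arm tie x t = i ∧ pulls tie x (t - 1) i = s) ↔
      (arm tie x' t = i ∧ pulls tie x' (t - 1) i = s) := by
  have key : ∀ {x x' : (c : Source K) → c.Value}, (∀ c, c ≠ .reward i s → x c = x' c) →
      (arm tie x t = i ∧ pulls tie x (t - 1) i = s) →
      (arm tie x' t = i ∧ pulls tie x' (t - 1) i = s) := by
    rintro x x' h ⟨h1, h2⟩
    have heq := pulls_congr h h2.le
    refine ⟨?_, by rw [← heq, h2]⟩
    rw [← h1]
    unfold arm
    rw [← heq]
    exact (nextArm_congr h _ h2.le).symm
  exact ⟨key h, key fun c hc => (h c hc).symm⟩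

/-! ### Pathwise counting of pulls. -/

theorem pulls_le (x : (c : Source K) → c.Value) (n : ℕ) (i : Fin K) : pulls tie x n i ≤ n := by
  induction n with
  | zero => exact le_rfl
  | succ n ih =>
    simp only [pulls]
    split_ifs <;> omega

theorem pulls_of_le (x : (c : Source K) → c.Value) {n : ℕ} (hn : n ≤ K) (i : Fin K) :
    pulls tie x n i = if (i : ℕ) < n then 1 else 0 := by
  induction n with
  | zero => simp [pulls]
  | succ n ih =>
    simp only [pulls, ih (by omega), nextArm, dif_pos (show n < K by omega), Fin.ext_iff]
    split_ifs <;> omega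

theorem pulls_eq_sum (x : (c : Source K) → c.Value) (n : ℕ) (i : Fin K) :
    pulls tie x n i = ∑ t ∈ Finset.Icc 1 n, if arm tie x t = i then 1 else 0 := by
  induction n with
  | zero => simp [pulls]
  | succ n ih => rw [Finset.sum_Icc_succ_top (by omega), ← ih]; rfl

/-- The pulls of an arm made after the `N`-th one are the rounds in which it is chosen after at
least `N` pulls. -/
theorem pulls_le_add_sum (x : (c : Source K) → c.Value) (n N : ℕ) (i : Fin K) :
    pulls tie x n i ≤ N + ∑ t ∈ Finset.Icc 1 n,
      if arm tie x t = i ∧ N ≤ pulls tie x (t - 1) i then 1 else 0 := by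
  induction n with
  | zero => simp [pulls]
  | succ n ih =>
    rw [Finset.sum_Icc_succ_top (by omega)]
    have harm : pulls tie x (n + 1) i = pulls tie x n i + if arm tie x (n + 1) = i then 1 else 0 :=
      rfl
    rw [harm, Nat.add_sub_cancel]
    by_cases h1 : arm tie x (n + 1) = i
    · by_cases h2 : N ≤ pulls tie x n i
      · simp only [h1, h2, and_self, if_true]; omega
      · simp only [h1, h2, and_false, if_true, if_false]; omega
    · simpa [h1] using ih

/-- Each initial round pulls an arm for the first time, so a repeated pull lies in the phase
governed by the confidence bounds. -/
theorem lt_of_arm_eq (x : (c : Source K) → c.Value) {t : ℕ} {i : Fin K} (ht : 1 ≤ t)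
    (ha : arm tie x t = i) (hp : 1 ≤ pulls tie x (t - 1) i) : K < t := by
  by_contra! h
  rw [pulls_of_le x (by omega)] at hp
  rw [arm, nextArm, dif_pos (by omega)] at ha
  rw [← ha] at hp
  simp at hp

theorem armUCB_le_of_arm_eq (htie : ∀ t S, S.Nonempty → tie t S ∈ S)
    (x : (c : Source K) → c.Value) {t : ℕ} {i : Fin K} (ht : K < t) (ha : arm tie x t = i)
    (j : Fin K) :
    armUCB x t j (pulls tie x (t - 1) j) ≤ armUCB x t i (pulls tie x (t - 1) i) := by
  classical
  rw [arm, nextArm, dif_neg (by omega), Nat.sub_add_cancel (by omega)] at ha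
  have hne : (Finset.univ.filter fun i => ∀ j, armUCB x t j (pulls tie x (t - 1) j) ≤
      armUCB x t i (pulls tie x (t - 1) i)).Nonempty := by
    obtain ⟨i₀, -, h⟩ := Finset.exists_max_image Finset.univ
      (fun i => armUCB x t i (pulls tie x (t - 1) i)) ⟨i, Finset.mem_univ i⟩
    exact ⟨i₀, by simpa using h⟩
  have := htie t _ hne
  have h2 := (Finset.mem_filter.1 this).2 j
  rwa [show tie t _ = i by convert ha] at h2

end Policy

/-! ### Independence of groups of sources -/

/-- The two-group statement is applied to one group against the union of the others, by induction on
the number of groups. -/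
theorem iIndep_iSup_of_disjoint {Ω ι J : Type*} {mΩ : MeasurableSpace Ω} {P : Measure Ω}
    [IsProbabilityMeasure P] {m : ι → MeasurableSpace Ω} (hle : ∀ i, m i ≤ mΩ) (h : iIndep m P)
    {S : J → Set ι} (hS : ∀ j j', j ≠ j' → Disjoint (S j) (S j')) :
    iIndep (fun j => ⨆ i ∈ S j, m i) P := by
  classical
  rw [iIndep_iff]
  intro s f hf
  induction s using Finset.induction_on with
  | empty => simp
  | insert j s hj ih =>
    rw [Finset.set_biInter_insert, Finset.prod_insert hj,
      ← ih fun i hi => hf i (Finset.mem_insert_of_mem hi)]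
    have hdisj : Disjoint (S j) (⋃ i ∈ s, S i) := by
      refine Set.disjoint_iUnion₂_right.2 fun i hi => hS j i ?_
      rintro rfl
      exact hj hi
    refine (Indep_iff _ _ _).1 (indep_iSup_of_disjoint hle h hdisj) _ _
      (hf j (Finset.mem_insert_self _ _)) (Finset.measurableSet_biInter _ fun i hi => ?_)
    have hmono : (⨆ c ∈ S i, m c) ≤ ⨆ c ∈ ⋃ i ∈ s, S i, m c :=
      biSup_mono fun c hc => Set.mem_iUnion₂.2 ⟨i, hi, hc⟩
    exact hmono _ (hf i (Finset.mem_insert_of_mem hi))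

theorem iIndepFun_of_measurable_iSup {Ω ι J : Type*} {mΩ : MeasurableSpace Ω} {P : Measure Ω}
    [IsProbabilityMeasure P] {m : ι → MeasurableSpace Ω} (hle : ∀ i, m i ≤ mΩ) (h : iIndep m P)
    {S : J → Set ι} (hS : ∀ j j', j ≠ j' → Disjoint (S j) (S j')) {β : J → Type*}
    [∀ j, MeasurableSpace (β j)] {f : ∀ j, Ω → β j}
    (hf : ∀ j, Measurable[⨆ i ∈ S j, m i] (f j)) : iIndepFun f P := by
  have := iIndep_iSup_of_disjoint hle h hS
  rw [iIndep_iff] at this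
  rw [iIndepFun_iff_iIndep, iIndep_iff]
  exact fun s g hg => this s fun j hj => (hf j).comap_le _ (hg j hj)

theorem measurable_comap_iSup {Ω ι : Type*} {β : ι → Type*} [∀ i, MeasurableSpace (β i)]
    (f : ∀ i, Ω → β i) {S : Set ι} {i : ι} (hi : i ∈ S) :
    Measurable[⨆ c ∈ S, MeasurableSpace.comap (f c) inferInstance] (f i) :=
  Measurable.mono (comap_measurable (f i))
    (le_iSup₂_of_le (f := fun c (_ : c ∈ S) => MeasurableSpace.comap (f c) inferInstance) i hi le_rfl)
    le_rfl

namespace IsRandomInput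

variable {Ω : Type*} [MeasurableSpace Ω] {P : Measure Ω} {K : ℕ} {ν : Fin K → Measure ℝ}
  {ξ : (c : Source K) → Ω → c.Value}

theorem comap_le (h : IsRandomInput P ν ξ) (c : Source K) :
    MeasurableSpace.comap (ξ c) inferInstance ≤ ‹MeasurableSpace Ω› := (h.measurable c).comap_le

theorem iIndep_comap (h : IsRandomInput P ν ξ) :
    iIndep (fun c => MeasurableSpace.comap (ξ c) inferInstance) P := h.indep.iIndep

end IsRandomInput

/-! ### Exchangeability of the reference variables at the true mean -/

/-- The `j`-th sign-perturbed copy of a centered sample. -/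
def flip {n m : ℕ} [NeZero m] (u : Fin n → Fin m → ℤˣ) (j : Fin m) (z : Fin n → ℝ) : Fin n → ℝ :=
  if j = 0 then z else fun r => ((u r j : ℤ) : ℝ) * z r

/-- Index `j` comes first among the values `F (flip u l z)`, with ties broken by `π`. -/
def IsFirst {n m : ℕ} [NeZero m] (F : (Fin n → ℝ) → ℝ) (u : Fin n → Fin m → ℤˣ)
    (π : Equiv.Perm (Fin m)) (j : Fin m) (z : Fin n → ℝ) : Prop :=
  ∀ l, l ≠ j → F (flip u j z) < F (flip u l z) ∨ (F (flip u j z) = F (flip u l z) ∧ π j < π l)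

/-- The change of signs that corresponds to swapping the original sample with the `j`-th copy. -/
def swapSigns {n m : ℕ} (j : Fin m) : Equiv.Perm (Fin n → Fin m → ℤˣ) :=
  Function.Involutive.toPerm (fun u r l => if l = j then u r j else u r l * u r j) fun u => by
    funext r l
    by_cases h : l = j
    · simp [h]
    · simp [h, mul_assoc]

theorem unit_cast_mul_self (e : ℤˣ) (y : ℝ) : ((e : ℤ) : ℝ) * (((e : ℤ) : ℝ) * y) = y := by
  rcases Int.units_eq_one_or e with h | h <;> simp [h]

/-- Take the `j`-th copy as the new original sample. Since a sign squares to `1`, flipping it by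
`u_j` restores the old original, and flipping it by `u_l u_j` gives the old `l`-th copy. The family
of samples is merely relabelled by the transposition of `0` and `j`. -/
theorem flip_swapSigns {n m : ℕ} [NeZero m] (u : Fin n → Fin m → ℤˣ) {j : Fin m} (hj : j ≠ 0)
    (l : Fin m) (z : Fin n → ℝ) :
    flip (swapSigns j u) l (fun r => ((u r j : ℤ) : ℝ) * z r) = flip u (Equiv.swap 0 j l) z := by
  have hs : swapSigns j u = fun r l => if l = j then u r j else u r l * u r j := rfl
  unfold flip
  rw [hs]
  by_cases h0 : l = 0
  · simp [h0, hj]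
  · by_cases hlj : l = j
    · subst hlj
      simp [h0, unit_cast_mul_self]
    · rw [Equiv.swap_apply_of_ne_of_ne h0 hlj]
      simp only [h0, if_false, hlj]
      funext r
      rw [Units.val_mul, Int.cast_mul, mul_assoc, unit_cast_mul_self]

/-- The tie-breaking order must be transported by the same transposition; otherwise ties would break
the exchangeability. -/
theorem isFirst_swapSigns {n m : ℕ} [NeZero m] (F : (Fin n → ℝ) → ℝ) (u : Fin n → Fin m → ℤˣ)
    (π : Equiv.Perm (Fin m)) {j : Fin m} (hj : j ≠ 0) (z : Fin n → ℝ) :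
    IsFirst F (swapSigns j u) ((Equiv.swap 0 j).trans π) 0 (fun r => ((u r j : ℤ) : ℝ) * z r) ↔
      IsFirst F u π j z := by
  simp only [IsFirst, flip_swapSigns u hj, Equiv.trans_apply, Equiv.swap_apply_left]
  constructor
  · intro h l hl
    have := h (Equiv.swap 0 j l) fun h0 => hl <|
      (Equiv.swap 0 j).injective (h0.trans (Equiv.swap_apply_right 0 j).symm)
    simpa using this
  · intro h l hl
    exact h _ fun h0 => hl <|
      (Equiv.swap 0 j).injective (h0.trans (Equiv.swap_apply_left 0 j).symm)

theorem measurable_flip {n m : ℕ} [NeZero m] (u : Fin n → Fin m → ℤˣ) (j : Fin m) :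
    Measurable (flip u j) := by
  unfold flip
  split_ifs
  · exact measurable_id
  · exact measurable_pi_lambda _ fun r => (measurable_pi_apply r).const_mul _

theorem measurableSet_isFirst {n m : ℕ} [NeZero m] {F : (Fin n → ℝ) → ℝ} (hF : Measurable F)
    (u : Fin n → Fin m → ℤˣ) (π : Equiv.Perm (Fin m)) (j : Fin m) :
    MeasurableSet {z | IsFirst F u π j z} := by
  have hm (l : Fin m) : Measurable fun z => F (flip u l z) := hF.comp (measurable_flip u l)
  simp only [IsFirst, Set.ofPred_forall]
  refine .iInter fun l => .iInter fun _ => ?_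
  exact (measurableSet_lt (hm j) (hm l)).union
    ((measurableSet_eq_fun (hm j) (hm l)).inter (.const _))

/-- Averaged over the signs and permutations, the original sample comes first with probability at
most `1 / m`. -/
theorem mul_sum_measure_isFirst_le {n m : ℕ} [NeZero m] (ρ : Measure ℝ) [IsProbabilityMeasure ρ]
    (hρ : ρ.map (fun y => -y) = ρ) {F : (Fin n → ℝ) → ℝ} (hF : Measurable F) :
    (m : ENNReal) * ∑ u : Fin n → Fin m → ℤˣ, ∑ π : Equiv.Perm (Fin m),
        Measure.pi (fun _ : Fin n => ρ) {z | IsFirst F u π 0 z} ≤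
      Fintype.card ((Fin n → Fin m → ℤˣ) × Equiv.Perm (Fin m)) := by
  set μ := Measure.pi fun _ : Fin n => ρ
  have hpres (e : Fin n → ℤˣ) : MeasurePreserving (fun z r => ((e r : ℤ) : ℝ) * z r) μ μ := by
    refine measurePreserving_pi (fun _ => ρ) (fun _ => ρ) fun r => ?_
    rcases Int.units_eq_one_or (e r) with h | h
    · convert MeasurePreserving.id ρ using 1
      funext y
      simp [h]
    · convert (⟨measurable_neg, hρ⟩ : MeasurePreserving (fun y : ℝ => -y) ρ ρ) using 1
      funext y
      simp [h]
  -- Every index is first equally often: the change of signs and of permutation is a bijection of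
  -- the finite set of patterns, and for fixed signs the map of `z` preserves the symmetric product
  -- law.
  have hswap (j : Fin m) : ∑ u : Fin n → Fin m → ℤˣ, ∑ π : Equiv.Perm (Fin m),
      μ {z | IsFirst F u π 0 z} = ∑ u : Fin n → Fin m → ℤˣ, ∑ π : Equiv.Perm (Fin m),
        μ {z | IsFirst F u π j z} := by
    rcases eq_or_ne j 0 with rfl | hj
    · rfl
    rw [← Equiv.sum_comp (swapSigns j)]
    refine Finset.sum_congr rfl fun u _ => ?_
    rw [← Equiv.sum_comp (Equiv.mulRight (Equiv.swap 0 j))]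
    refine Finset.sum_congr rfl fun π _ => ?_
    rw [← (hpres fun r => u r j).measure_preimage
      (measurableSet_isFirst hF _ _ _).nullMeasurableSet]
    congr 1
    ext z
    exact isFirst_swapSigns F u π hj z
  calc (m : ENNReal) * ∑ u : Fin n → Fin m → ℤˣ, ∑ π : Equiv.Perm (Fin m),
        μ {z | IsFirst F u π 0 z}
      = ∑ j : Fin m, ∑ u : Fin n → Fin m → ℤˣ, ∑ π : Equiv.Perm (Fin m),
          μ {z | IsFirst F u π j z} := by
        rw [← Finset.sum_congr rfl fun j _ => hswap j]
        simp
    _ = ∑ u : Fin n → Fin m → ℤˣ, ∑ π : Equiv.Perm (Fin m), ∑ j : Fin m,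
          μ {z | IsFirst F u π j z} := by
        rw [Finset.sum_comm]
        exact Finset.sum_congr rfl fun u _ => Finset.sum_comm
    _ ≤ ∑ u : Fin n → Fin m → ℤˣ, ∑ π : Equiv.Perm (Fin m), 1 := by
        refine Finset.sum_le_sum fun u _ => Finset.sum_le_sum fun π _ => ?_
        -- For a fixed pattern at most one index can be first, so these probabilities add up to at
        -- most `1`.
        rw [← measure_biUnion_finset (fun j _ l _ hjl => ?_)
          fun j _ => measurableSet_isFirst hF u π j]
        · exact prob_le_one
        · refine Set.disjoint_left.2 fun z hz hz' => ?_
          rcases hz l hjl.symm with h | ⟨h, h'⟩ <;> rcases hz' j hjl with g | ⟨g, g'⟩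
          · exact lt_asymm h g
          · exact h.ne' g
          · exact g.ne' h
          · exact lt_asymm h' g'
    _ = Fintype.card ((Fin n → Fin m → ℤˣ) × Equiv.Perm (Fin m)) := by
        simp [Fintype.card_prod]

/-! ### The level of the upper confidence bound -/

/-- The sign of a real number that is `1` or `-1`. -/
noncomputable def unitSign (v : ℝ) : ℤˣ := open Classical in if v = 1 then 1 else -1

instance : MeasurableSingletonClass ℤˣ :=
  ⟨fun e => ⟨{(e : ℤ)}, measurableSet_singleton _, by ext; simp [Units.ext_iff]⟩⟩

theorem measurable_unitSign : Measurable unitSign :=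
  Measurable.ite (measurableSet_singleton 1) measurable_const measurable_const

instance : IsProbabilityMeasure rademacher := ⟨by
  simp [rademacher, ENNReal.inv_two_add_inv_two]⟩

theorem rademacher_preimage_unitSign (e : ℤˣ) : rademacher (unitSign ⁻¹' {e}) = 2⁻¹ := by
  have h1 : unitSign 1 = 1 := by simp [unitSign]
  have h2 : unitSign (-1) = -1 := by
    rw [unitSign, if_neg (by norm_num)]
  have hm : MeasurableSet (unitSign ⁻¹' {e}) := measurable_unitSign (measurableSet_singleton e)
  have : (1 : ℤˣ) ≠ -1 := by decide
  rw [rademacher, Measure.add_apply, Measure.smul_apply, Measure.smul_apply,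
    Measure.dirac_apply' _ hm, Measure.dirac_apply' _ hm]
  rcases Int.units_eq_one_or e with rfl | rfl <;> simp [Set.indicator, h1, h2, this, this.symm]

theorem ae_rademacher : ∀ᵐ v ∂rademacher, v = 1 ∨ v = -1 := by
  rw [rademacher, ae_add_measure_iff]
  have hm (v : ℝ) : MeasurableSet {v : ℝ | v = 1 ∨ v = -1} :=
    (measurableSet_singleton _).union (measurableSet_singleton _)
  constructor <;> refine Measure.ae_smul_measure ?_ _ <;> rw [ae_dirac_iff (hm 0)] <;> simp

theorem symmetricAbout_map_sub {ν : Measure ℝ} {c : ℝ} (h : SymmetricAbout ν c) :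
    (ν.map (fun y => y - c)).map (fun y => -y) = ν.map (fun y => y - c) := by
  rw [Measure.map_map measurable_neg (by fun_prop)]
  conv_rhs => rw [← h]
  rw [Measure.map_map (by fun_prop) (by fun_prop)]
  congr 1
  funext y
  simp only [Function.comp_apply]
  ring

section Inputs

variable {Ω : Type*} {K : ℕ} (ξ : (c : Source K) → Ω → c.Value)

/-- The `s`-th reward of arm `i`, as a real random variable. -/
def rewardInput (i : Fin K) (s : ℕ) : Ω → ℝ := ξ (.reward i s)

/-- A random sign, as a real random variable. -/
def signInput (t : ℕ) (i : Fin K) (s j : ℕ) : Ω → ℝ := ξ (.sign t i s j)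

/-- The random permutation for arm `i` in round `t`. -/
def permInput (t : ℕ) (i : Fin K) : Ω → Equiv.Perm (Fin (levelDen t)) := ξ (.perm t i)

end Inputs

namespace IsRandomInput

variable {Ω : Type*} [MeasurableSpace Ω] {P : Measure Ω} {K : ℕ} {ν : Fin K → Measure ℝ}
  {ξ : (c : Source K) → Ω → c.Value}

theorem map_reward (h : IsRandomInput P ν ξ) (i : Fin K) (s : ℕ) :
    P.map (rewardInput ξ i s) = ν i := h.map_eq (.reward i s)

theorem map_sign (h : IsRandomInput P ν ξ) (t : ℕ) (i : Fin K) (s j : ℕ) :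
    P.map (signInput ξ t i s j) = rademacher := h.map_eq (.sign t i s j)

theorem measurable_reward (h : IsRandomInput P ν ξ) (i : Fin K) (s : ℕ) :
    Measurable (rewardInput ξ i s) := h.measurable (.reward i s)

theorem measurable_sign (h : IsRandomInput P ν ξ) (t : ℕ) (i : Fin K) (s j : ℕ) :
    Measurable (signInput ξ t i s j) := h.measurable (.sign t i s j)

theorem measurable_perm (h : IsRandomInput P ν ξ) (t : ℕ) (i : Fin K) :
    Measurable (permInput ξ t i) :=
  h.measurable (.perm t i)

theorem ae_sign (h : IsRandomInput P ν ξ) (t : ℕ) (i : Fin K) (s j : ℕ) :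
    ∀ᵐ ω ∂P, signInput ξ t i s j ω = 1 ∨ signInput ξ t i s j ω = -1 := by
  have := ae_rademacher
  rw [← h.map_sign t i s j] at this
  exact ae_of_ae_map (h.measurable_sign t i s j).aemeasurable this

/-- The signs and the permutation used for arm `i` in round `t` with `n` observations. -/
noncomputable def pattern (ξ : (c : Source K) → Ω → c.Value) (t : ℕ) (i : Fin K) (n : ℕ) (ω : Ω) :
    (Fin n → Fin (levelDen t) → ℤˣ) × Equiv.Perm (Fin (levelDen t)) :=
  (fun r j => unitSign (signInput ξ t i r j ω), permInput ξ t i ω)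

/-- The source of a coordinate of the pattern. -/
def patternSource (t : ℕ) (i : Fin K) (n : ℕ) :
    (Fin n × Fin (levelDen t)) ⊕ Unit → Source K
  | .inl p => .sign t i p.1 p.2
  | .inr _ => .perm t i

theorem patternSource_injective (t : ℕ) (i : Fin K) (n : ℕ) :
    Function.Injective (patternSource t i n) := by
  rintro (⟨r, j⟩ | _) (⟨r', j'⟩ | _) h
  · simp only [patternSource, Source.sign.injEq, true_and] at h
    simp [Fin.ext_iff, h.1, h.2]
  · simp [patternSource] at h
  · simp [patternSource] at h
  · rfl

/-- Signs and permutation are independent and uniform, so the pattern is uniform on a finite set.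
This turns the probability of being first into the average over patterns bounded by
`mul_sum_measure_isFirst_le`. -/
theorem measure_pattern [IsProbabilityMeasure P] (h : IsRandomInput P ν ξ) (t : ℕ) (i : Fin K) (n : ℕ)
    (w : (Fin n → Fin (levelDen t) → ℤˣ) × Equiv.Perm (Fin (levelDen t))) :
    P {ω | pattern ξ t i n ω = w} =
      (Fintype.card ((Fin n → Fin (levelDen t) → ℤˣ) × Equiv.Perm (Fin (levelDen t))) : ENNReal)⁻¹ := by
  have hind := h.indep.precomp (patternSource_injective t i n)
  let B : (c : (Fin n × Fin (levelDen t)) ⊕ Unit) → Set (patternSource t i n c).Value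
    | .inl p => (unitSign ⁻¹' {w.1 p.1 p.2} : Set ℝ)
    | .inr _ => ({w.2} : Set (Equiv.Perm (Fin (levelDen t))))
  have hB : ∀ c, MeasurableSet (B c) := by
    rintro (p | _)
    · exact measurable_unitSign (measurableSet_singleton _)
    · exact trivial
  have hprod := hind.measure_inter_preimage_eq_mul Finset.univ (sets := B) fun c _ => hB c
  have hev : {ω | pattern ξ t i n ω = w} =
      ⋂ c ∈ Finset.univ, ξ (patternSource t i n c) ⁻¹' B c := by
    ext ω
    simp only [Set.mem_ofPred_eq, Finset.mem_univ, Set.iInter_true, Set.mem_iInter]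
    constructor
    · rintro rfl (p | _) <;> rfl
    · intro hω
      refine Prod.ext (funext fun r => funext fun j => hω (.inl (r, j))) (hω (.inr ()))
  rw [hev, hprod, Fintype.prod_sum_type]
  have h1 : ∀ p, P (ξ (patternSource t i n (.inl p)) ⁻¹' B (.inl p)) = 2⁻¹ := fun p => by
    rw [← rademacher_preimage_unitSign (w.1 p.1 p.2), ← h.map_sign t i p.1 p.2,
      Measure.map_apply (h.measurable_sign t i p.1 p.2)
        (measurable_unitSign (measurableSet_singleton _))]
    rfl
  have h2 : P (ξ (patternSource t i n (.inr ())) ⁻¹' B (.inr ())) =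
      (Fintype.card (Equiv.Perm (Fin (levelDen t))) : ENNReal)⁻¹ := by
    have h3 := h.map_eq (.perm t i)
    have h4 : (PMF.uniformOfFintype (Equiv.Perm (Fin (levelDen t)))).toMeasure {w.2} =
        (Fintype.card (Equiv.Perm (Fin (levelDen t))) : ENNReal)⁻¹ := by
      rw [PMF.toMeasure_apply_singleton _ _ MeasurableSpace.measurableSet_top, PMF.uniformOfFintype_apply]
    rw [← h4]
    have h5 : P.map (permInput ξ t i) =
        (PMF.uniformOfFintype (Equiv.Perm (Fin (levelDen t)))).toMeasure := h3
    rw [← h5, Measure.map_apply (h.measurable_perm t i) MeasurableSpace.measurableSet_top]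
    rfl
  simp only [h1, h2, Finset.prod_const, Finset.card_univ, Finset.univ_unique, Finset.card_singleton]
  rw [Fintype.card_prod (Fin n → Fin (levelDen t) → ℤˣ), Nat.cast_mul, ENNReal.mul_inv (by simp) (by simp)]
  rw [pow_one, ← ENNReal.inv_pow]
  simp [Fintype.card_prod, ← pow_mul, mul_comm]

/-- The centered observations. -/
theorem map_centered [IsProbabilityMeasure P] (h : IsRandomInput P ν ξ) (i : Fin K) (n : ℕ) (c : ℝ) :
    P.map (fun ω (r : Fin n) => rewardInput ξ i r ω - c) =
      Measure.pi fun _ : Fin n => (ν i).map (fun y => y - c) := by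
  have hinj : Function.Injective fun r : Fin n => Source.reward i (r : ℕ) := fun r r' hr => by
    simpa [Fin.ext_iff] using hr
  have hind := (h.indep.precomp hinj).comp (fun _ (y : ℝ) => y - c) fun _ => measurable_id.sub_const c
  have := (iIndepFun_iff_map_fun_eq_pi_map fun r : Fin n =>
    ((h.measurable_reward i r).sub_const c).aemeasurable).1 hind
  refine this.trans (congrArg Measure.pi (funext fun r => ?_))
  rw [← h.map_reward i r, Measure.map_map (by fun_prop) (h.measurable_reward i r)]
  rfl

theorem indepFun_centered_pattern [IsProbabilityMeasure P] (h : IsRandomInput P ν ξ) (t : ℕ)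
    (i : Fin K) (n : ℕ) (c : ℝ) :
    IndepFun (fun ω (r : Fin n) => rewardInput ξ i r ω - c) (pattern ξ t i n) P := by
  have hdisj : Disjoint (Set.range fun r : ℕ => Source.reward i r)
      (Set.range (patternSource t i n)) := by
    refine Set.disjoint_left.2 ?_
    rintro _ ⟨r, rfl⟩ ⟨(p | _), hp⟩ <;> simp [patternSource] at hp
  refine (IndepFun_iff_Indep _ _ _).2 (indep_of_indep_of_le_left (indep_of_indep_of_le_right
    (indep_iSup_of_disjoint h.comap_le h.iIndep_comap hdisj) ?_) ?_)
  · refine Measurable.comap_le (@Measurable.prodMk _ _ _ _ _ (_) _ _ ?_ ?_)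
    · change @Measurable Ω _ (_) _ fun ω (r : Fin n) (j : Fin (levelDen t)) => unitSign (signInput ξ t i r j ω)
      refine @measurable_pi_lambda _ _ _ (_) _ _ fun r => @measurable_pi_lambda _ _ _ (_) _ _ fun j => ?_
      exact measurable_unitSign.comp (measurable_comap_iSup ξ
        (i := Source.sign t i r j) ⟨.inl (r, j), rfl⟩)
    · exact measurable_comap_iSup ξ (i := Source.perm t i) ⟨.inr (), rfl⟩
  · refine Measurable.comap_le (@measurable_pi_lambda _ _ _ (_) _ _ fun r => ?_)
    have : Measurable fun y : ℝ => y - c := by fun_prop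
    exact this.comp (measurable_comap_iSup ξ (i := Source.reward i (r : ℕ)) ⟨r, rfl⟩)

/-- At the true mean, the original sample comes first with probability at most the level. -/
theorem measure_forall_precedes_le [IsProbabilityMeasure P] (h : IsRandomInput P ν ξ)
    {i : Fin K} [IsProbabilityMeasure (ν i)] {c : ℝ} (hsymm : SymmetricAbout (ν i) c)
    (t n k : ℕ) :
    P {ω | ∀ j : Fin (levelDen t), j ≠ 0 → Precedes (refVar n k (fun s => rewardInput ξ i s ω)
        (fun s j => signInput ξ t i s j ω) c) (permInput ξ t i ω) 0 j} ≤
      (levelDen t : ENNReal)⁻¹ := by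
  -- All reference variables at `c` are one statistic `F` of the flipped centered samples. Entries
  -- with index at least `n` do not enter any block, so `0` is an arbitrary filler. Nothing is
  -- required of `k`, which may be `0`.
  let F : (Fin n → ℝ) → ℝ := fun d =>
    medianOfMeans n k (fun r => if hr : r < n then d ⟨r, hr⟩ + c else 0) - c
  have hF : Measurable F := by
    refine ((continuous_medianOfMeans n k).measurable.comp (measurable_pi_lambda _ fun r => ?_)).sub_const _
    split_ifs <;> fun_prop
  set Z := fun ω (r : Fin n) => rewardInput ξ i r ω - c
  have hZ : Measurable Z := measurable_pi_lambda _ fun r => (h.measurable_reward i r).sub_const c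
  let A := fun w : (Fin n → Fin (levelDen t) → ℤˣ) × Equiv.Perm (Fin (levelDen t)) =>
    {z | IsFirst F w.1 w.2 0 z}
  have hA (w) : MeasurableSet (A w) := measurableSet_isFirst hF _ _ _
  have hsign : ∀ᵐ ω ∂P, ∀ s j, signInput ξ t i s j ω = 1 ∨ signInput ξ t i s j ω = -1 :=
    ae_all_iff.2 fun s => ae_all_iff.2 fun j => h.ae_sign t i s j
  have hsub : {ω | ∀ j : Fin (levelDen t), j ≠ 0 → Precedes (refVar n k
      (fun s => rewardInput ξ i s ω) (fun s j => signInput ξ t i s j ω) c) (permInput ξ t i ω) 0 j}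
      ≤ᵐ[P] ⋃ w, (Z ⁻¹' A w ∩ pattern ξ t i n ⁻¹' {w} : Set Ω) := by
    filter_upwards [hsign] with ω hω hfirst
    refine Set.mem_iUnion.2 ⟨pattern ξ t i n ω, ?_, rfl⟩
    have href (j : Fin (levelDen t)) : refVar n k (fun s => rewardInput ξ i s ω)
        (fun s j => signInput ξ t i s j ω) c j = F (flip (pattern ξ t i n ω).1 j (Z ω)) := by
      simp only [refVar, F]
      congr 1
      refine medianOfMeans_congr fun r hr => ?_
      have hu : ((unitSign (signInput ξ t i r j ω) : ℤ) : ℝ) = signInput ξ t i r j ω := by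
        rcases hω r j with h1 | h1
        · simp [h1, unitSign]
        · rw [h1, unitSign, if_neg (by norm_num)]
          simp
      by_cases hj : j = 0
      · simp [altSample, hr, flip, hj, Z]
      · have : (j : ℕ) ≠ 0 := fun h0 => hj (Fin.ext h0)
        simp [altSample, hr, flip, hj, Z, this, pattern, hu]
    intro l hl
    have := hfirst l hl
    simp only [Precedes, href] at this
    exact this
  calc P _ ≤ P (⋃ w, (Z ⁻¹' A w ∩ pattern ξ t i n ⁻¹' {w} : Set Ω)) := measure_mono_ae hsub
    _ ≤ ∑ w, P (Z ⁻¹' A w ∩ pattern ξ t i n ⁻¹' {w}) := measure_iUnion_fintype_le _ _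
    _ = ∑ w, (Measure.pi fun _ : Fin n => (ν i).map (fun y => y - c)) (A w) *
          (Fintype.card ((Fin n → Fin (levelDen t) → ℤˣ) × Equiv.Perm (Fin (levelDen t))) : ENNReal)⁻¹ := by
        refine Finset.sum_congr rfl fun w _ => ?_
        rw [(h.indepFun_centered_pattern t i n c).measure_inter_preimage_eq_mul _ _ (hA w)
          (measurableSet_singleton w), ← h.map_centered i n c, Measure.map_apply hZ (hA w),
          ← h.measure_pattern t i n w]
        rfl
    _ ≤ (levelDen t : ENNReal)⁻¹ := by
        have : IsProbabilityMeasure ((ν i).map fun y => y - c) :=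
          Measure.isProbabilityMeasure_map (by fun_prop)
        have hmain := mul_sum_measure_isFirst_le (m := levelDen t) _ (symmetricAbout_map_sub hsymm) hF
        rw [← Finset.sum_mul, Fintype.sum_prod_type, ENNReal.le_inv_iff_mul_le, mul_right_comm,
          mul_comm _ (levelDen t : ENNReal)]
        exact (mul_le_mul' hmain le_rfl).trans (ENNReal.mul_inv_le_one _)

end IsRandomInput

/-! ### The upper confidence bound on samples with few bad blocks -/

/-- The average over the `l`-th block. -/
noncomputable def blockAvg (n k l : ℕ) (y : ℕ → ℝ) : ℝ :=
  (∑ i ∈ block n k l, y i) / ((block n k l).card : ℝ)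

/-- Fewer than half of the blocks have a deviation above `η` or a sign average above `1 / 2`. -/
def FewBadBlocks (n k : ℕ) (y a : ℕ → ℝ) (η : ℝ) : Prop :=
  open Classical in
  2 * (Finset.univ.filter fun l : Fin k => η < |blockAvg n k l y| ∨ 1 / 2 < blockAvg n k l a).card < k

/-- The centered sample (`j = 0`) or its `j`-th perturbation. -/
def perturbed (x : ℕ → ℝ) (α : ℕ → ℕ → ℝ) (c : ℝ) (j : ℕ) : ℕ → ℝ :=
  fun r => if j = 0 then x r - c else α r j * (x r - c)

theorem card_block_pos {n k l : ℕ} (hl : l < k) (hk : k ≤ n) : 0 < (block n k l).card :=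
  lt_of_lt_of_le (Nat.div_pos hk (by omega)) (card_block_ge hl)

section Bounds

variable {n k : ℕ} {x : ℕ → ℝ} {α : ℕ → ℕ → ℝ} {c η : ℝ}

theorem blockAvg_altSample_zero {l : ℕ} (hl : l < k) (hk : k ≤ n) (θ : ℝ) :
    blockAvg n k l (altSample x α θ 0) = blockAvg n k l (perturbed x α c 0) + c := by
  have := card_block_pos hl hk
  simp only [blockAvg, altSample, perturbed, if_true, Finset.sum_sub_distrib, Finset.sum_const,
    nsmul_eq_mul]
  field_simp
  ring

/-- A flipped observation is `α (x - c) + (θ - c)(1 - α) + c`. The middle term is the drift that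
separates the copy from the original sample when `θ ≠ c`; the sign average has to stay away from `1`
for it to be felt. -/
theorem blockAvg_altSample {j l : ℕ} (hj : j ≠ 0) (hl : l < k) (hk : k ≤ n) (θ : ℝ) :
    blockAvg n k l (altSample x α θ j) =
      blockAvg n k l (perturbed x α c j) + (θ - c) * (1 - blockAvg n k l (fun r => α r j)) + c := by
  have := card_block_pos hl hk
  have hsum : ∑ i ∈ block n k l, altSample x α θ j i = ∑ i ∈ block n k l, perturbed x α c j i -
      (θ - c) * ∑ i ∈ block n k l, α i j + (block n k l).card * θ := by
    rw [Finset.mul_sum, ← Finset.sum_sub_distrib, ← nsmul_eq_mul, ← Finset.sum_const,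
      ← Finset.sum_add_distrib]
    refine Finset.sum_congr rfl fun i _ => ?_
    simp only [altSample, perturbed, hj, if_false]
    ring
  simp only [blockAvg, hsum]
  field_simp
  ring

/-- A median ignores any minority of blocks, so the bound is needed only on the good ones. -/
theorem FewBadBlocks.le_medianOfMeans {y a : ℕ → ℝ} (h : FewBadBlocks n k y a η) {w : ℕ → ℝ} {b : ℝ}
    (hw : ∀ l < k, |blockAvg n k l y| ≤ η → blockAvg n k l a ≤ 1 / 2 → b ≤ blockAvg n k l w) :
    b ≤ medianOfMeans n k w := by
  classical
  have hk : 0 < k := by unfold FewBadBlocks at h; omega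
  refine le_empMedian hk (lt_of_le_of_lt (Nat.mul_le_mul_left 2 (Finset.card_le_card ?_)) h)
  intro l hl
  simp only [Finset.mem_filter, Finset.mem_univ, true_and] at hl ⊢
  by_contra! hno
  exact absurd (hw l l.2 hno.1 hno.2) (not_le.2 hl)

theorem FewBadBlocks.medianOfMeans_le {y a : ℕ → ℝ} (h : FewBadBlocks n k y a η) {w : ℕ → ℝ} {b : ℝ}
    (hw : ∀ l < k, |blockAvg n k l y| ≤ η → blockAvg n k l a ≤ 1 / 2 → blockAvg n k l w ≤ b) :
    medianOfMeans n k w ≤ b := by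
  classical
  have hk : 0 < k := by unfold FewBadBlocks at h; omega
  refine empMedian_le hk (lt_of_le_of_lt (Nat.mul_le_mul_left 2 (Finset.card_le_card ?_)) h)
  intro l hl
  simp only [Finset.mem_filter, Finset.mem_univ, true_and] at hl ⊢
  by_contra! hno
  exact absurd (hw l l.2 hno.1 hno.2) (not_le.2 hl)

theorem coe_le_ucb {m : ℕ} [NeZero m] {π : Equiv.Perm (Fin m)} {θ : ℝ}
    (h : ¬ ∀ j : Fin m, j ≠ 0 → Precedes (refVar n k x α θ) π 0 j) :
    (θ : EReal) ≤ ucb 1 m n k x α π := by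
  push Not at h
  exact le_sSup ⟨θ, rank_le_sub_one_iff.2 h, rfl⟩

/-- For `θ > c + 4η` each copy has median at least `c - η + (θ - c)/2`, which exceeds the bound `c +
η` for the original. The original then precedes all copies, and `θ` is rejected. -/
theorem ucb_le_of_fewBadBlocks {m : ℕ} [NeZero m] {π : Equiv.Perm (Fin m)} (hkn : k ≤ n)
    (h : ∀ j : Fin m, FewBadBlocks n k (perturbed x α c j) (fun r => α r j) η) :
    ucb 1 m n k x α π ≤ ((c + 4 * η : ℝ) : EReal) := by
  by_contra! hlt
  obtain ⟨j, hj, θ, hθ, hp⟩ := lt_ucb_iff.1 hlt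
  rw [EReal.coe_lt_coe_iff] at hθ
  have hj' : (j : ℕ) ≠ 0 := fun h0 => hj (Fin.ext h0)
  have h0 : medianOfMeans n k (altSample x α θ 0) ≤ c + η :=
    (h 0).medianOfMeans_le fun l hl hy _ => by
      rw [Fin.val_zero] at hy
      rw [blockAvg_altSample_zero (c := c) hl hkn]
      linarith [(abs_le.1 hy).2]
  have h1 : c - η + (θ - c) / 2 ≤ medianOfMeans n k (altSample x α θ j) :=
    (h j).le_medianOfMeans fun l hl hy ha => by
      rw [blockAvg_altSample (c := c) hj' hl hkn]
      have := (abs_nonneg _).trans hy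
      nlinarith [(abs_le.1 hy).1, mul_nonneg (show 0 ≤ θ - c by linarith) (sub_nonneg.2 ha)]
  refine hp (Or.inl ?_)
  simp only [refVar, Fin.val_zero]
  linarith

/-- One copy suffices here: at `θ = c - δ` the drift pulls the first copy below the original sample,
so `θ` is accepted. Hence only two good events enter, instead of one per copy. -/
theorem coe_le_ucb_of_fewBadBlocks {m : ℕ} [NeZero m] {π : Equiv.Perm (Fin m)} (hkn : k ≤ n)
    (hm : 2 ≤ m) (hη : 0 ≤ η)
    (h0 : FewBadBlocks n k (perturbed x α c 0) (fun r => α r 0) η)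
    (h1 : FewBadBlocks n k (perturbed x α c 1) (fun r => α r 1) η) {δ : ℝ} (hδ : 4 * η < δ) :
    ((c - δ : ℝ) : EReal) ≤ ucb 1 m n k x α π := by
  refine coe_le_ucb fun hall => ?_
  have hlow : c - η ≤ medianOfMeans n k (altSample x α (c - δ) 0) :=
    h0.le_medianOfMeans fun l hl hy _ => by
      rw [blockAvg_altSample_zero (c := c) hl hkn]
      linarith [(abs_le.1 hy).1]
  have hupp : medianOfMeans n k (altSample x α (c - δ) 1) ≤ c + η - δ / 2 :=
    h1.medianOfMeans_le fun l hl hy ha => by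
      rw [blockAvg_altSample (c := c) one_ne_zero hl hkn]
      nlinarith [(abs_le.1 hy).2, mul_nonneg (show 0 ≤ δ by linarith) (sub_nonneg.2 ha)]
  have hlt : medianOfMeans n k (altSample x α (c - δ) 1) < medianOfMeans n k (altSample x α (c - δ) 0) := by
    linarith
  have := hall ⟨1, hm⟩ (by simp [Fin.ext_iff])
  simp only [Precedes, refVar, Fin.val_zero] at this
  rcases this with h | ⟨h, -⟩ <;> linarith

end Bounds

/-! ### Tails of averages of independent symmetric variables -/

section Tail

variable {Ω : Type*} [MeasurableSpace Ω] {P : Measure Ω} [IsProbabilityMeasure P]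

/-- Chebyshev's inequality after truncation, for independent symmetric variables with a common law
that has a moment of order `1 + a`. -/
theorem measure_lt_abs_sum_le {ι : Type*} (b : Finset ι) (Y : ι → Ω → ℝ) (hY : ∀ i, Measurable (Y i))
    (hind : (b : Set ι).Pairwise fun i j => IndepFun (Y i) (Y j) P) {ρ : Measure ℝ}
    [IsProbabilityMeasure ρ] (hρ : ρ.map (fun y => -y) = ρ) (hlaw : ∀ i ∈ b, P.map (Y i) = ρ)
    {a M c : ℝ} (ha0 : 0 < a) (ha1 : a ≤ 1) (hint : Integrable (fun y => |y| ^ (1 + a)) ρ)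
    (hM : ∫ y, |y| ^ (1 + a) ∂ρ = M) (hc : 0 < c) :
    P.real {ω | c < |∑ i ∈ b, Y i ω|} ≤ 2 * b.card * (M / c ^ (1 + a)) := by
  classical
  -- Truncation at the level `c` of the deviation itself. As `τ` is odd, symmetry keeps the
  -- truncated variables centered and there is no bias to control.
  let τ : ℝ → ℝ := fun y => if |y| ≤ c then y else 0
  have hτm : Measurable τ :=
    Measurable.ite (measurableSet_le measurable_id.abs measurable_const) measurable_id measurable_const
  have hτb : ∀ y, |τ y| ≤ c := fun y => by
    simp only [τ]; split_ifs with h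
    · exact h
    · simpa using hc.le
  have hca : 0 < c ^ (1 + a) := Real.rpow_pos_of_pos hc _
  have hM0 : 0 ≤ M := hM ▸ integral_nonneg fun y => by positivity
  -- large values
  have h1 : ∀ i ∈ b, P.real {ω | c < |Y i ω|} ≤ M / c ^ (1 + a) := by
    intro i hi
    have hset : MeasurableSet {y : ℝ | c < |y|} := measurableSet_lt measurable_const measurable_id.abs
    have : P.real {ω | c < |Y i ω|} = ρ.real {y | c < |y|} := by
      rw [← hlaw i hi, map_measureReal_apply (hY i) hset]
      rfl
    rw [this, le_div_iff₀' hca]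
    refine le_trans ?_ (hM ▸ mul_meas_ge_le_integral_of_nonneg (ae_of_all _ fun y => by positivity) hint (c ^ (1 + a)))
    refine mul_le_mul_of_nonneg_left (measureReal_mono ?_) hca.le
    intro y hy
    exact Real.rpow_le_rpow hc.le (le_of_lt hy) (by linarith)
  -- the truncated sum
  have hmem : ∀ i, MemLp (fun ω => τ (Y i ω)) 2 P := fun i =>
    MemLp.of_bound (hτm.comp (hY i)).aestronglyMeasurable c (ae_of_all _ fun ω => hτb _)
  have hmean : ∫ y, τ y ∂ρ = 0 := by
    have hodd : ∀ y, τ (-y) = - τ y := fun y => by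
      simp only [τ, abs_neg]; split_ifs <;> simp
    have : ∫ y, τ y ∂ρ = ∫ y, τ (-y) ∂ρ := by
      conv_lhs => rw [← hρ]
      exact integral_map measurable_neg.aemeasurable hτm.aestronglyMeasurable
    simp only [hodd, integral_neg] at this
    linarith
  have hmeani : ∀ i ∈ b, ∫ ω, τ (Y i ω) ∂P = 0 := fun i hi => by
    rw [← hmean, ← hlaw i hi, integral_map (hY i).aemeasurable hτm.aestronglyMeasurable]
  -- On `|y| ≤ c` one has `y² ≤ |y|^(1+a) c^(1-a)`, where `a ≤ 1` is needed.
  have hsq : ∫ y, τ y ^ 2 ∂ρ ≤ c ^ 2 * (M / c ^ (1 + a)) := by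
    rw [mul_div_assoc', mul_comm, mul_div_assoc, ← hM, ← integral_mul_const]
    refine integral_mono_of_nonneg (ae_of_all _ fun y => sq_nonneg _) (hint.mul_const _)
      (ae_of_all _ fun y => ?_)
    simp only [τ]
    split_ifs with h
    · rcases eq_or_ne y 0 with rfl | hy
      · simp only [ne_eq, OfNat.ofNat_ne_zero, not_false_eq_true, zero_pow]
        positivity
      have hy0 : 0 < |y| := abs_pos.2 hy
      have e1 : y ^ 2 = |y| ^ (1 + a) * |y| ^ (1 - a) := by
        rw [← Real.rpow_add hy0, ← sq_abs, ← Real.rpow_natCast]; norm_num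
      have e2 : c ^ 2 / c ^ (1 + a) = c ^ (1 - a) := by
        rw [← Real.rpow_natCast, ← Real.rpow_sub hc]; norm_num
        congr 1; ring
      rw [e1, e2]
      exact mul_le_mul_of_nonneg_left (Real.rpow_le_rpow hy0.le h (by linarith)) (by positivity)
    · simp only [ne_eq, OfNat.ofNat_ne_zero, not_false_eq_true, zero_pow]
      positivity
  have hvar : Var[∑ i ∈ b, fun ω => τ (Y i ω); P] ≤ b.card * (c ^ 2 * (M / c ^ (1 + a))) := by
    rw [IndepFun.variance_sum (fun i _ => hmem i) fun i hi j hj hij => (hind hi hj hij).comp hτm hτm,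
      ← nsmul_eq_mul]
    refine Finset.sum_le_card_nsmul _ _ _ fun i hi => ?_
    refine (variance_le_expectation_sq (hmem i).aestronglyMeasurable).trans ?_
    refine le_trans (le_of_eq ?_) hsq
    rw [← hlaw i hi, integral_map (hY i).aemeasurable (hτm.pow_const 2).aestronglyMeasurable]
    rfl
  have hsumMem : MemLp (∑ i ∈ b, fun ω => τ (Y i ω)) 2 P := memLp_finsetSum' _ fun i _ => hmem i
  have h2 : P.real {ω | c ≤ |∑ i ∈ b, τ (Y i ω)|} ≤ b.card * (M / c ^ (1 + a)) := by
    have := meas_ge_le_variance_div_sq hsumMem hc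
    have hE : ∫ ω, (∑ i ∈ b, fun ω => τ (Y i ω)) ω ∂P = 0 := by
      simp only [Finset.sum_apply]
      rw [integral_finsetSum _ fun i _ => (hmem i).integrable (by norm_num)]
      exact Finset.sum_eq_zero hmeani
    rw [hE] at this
    simp only [Finset.sum_apply, sub_zero] at this
    refine (ENNReal.toReal_mono ENNReal.ofReal_ne_top this).trans ?_
    rw [ENNReal.toReal_ofReal (div_nonneg (variance_nonneg _ _) (sq_nonneg _)),
      div_le_iff₀ (by positivity)]
    refine hvar.trans (le_of_eq ?_)
    ring
  have hsub : {ω | c < |∑ i ∈ b, Y i ω|} ⊆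
      (⋃ i ∈ b, {ω | c < |Y i ω|}) ∪ {ω | c ≤ |∑ i ∈ b, τ (Y i ω)|} := by
    intro ω hω
    by_cases h : ∃ i ∈ b, c < |Y i ω|
    · exact Or.inl (by simpa using h)
    · push Not at h
      refine Or.inr ?_
      have : ∑ i ∈ b, τ (Y i ω) = ∑ i ∈ b, Y i ω :=
        Finset.sum_congr rfl fun i hi => if_pos (h i hi)
      simp only [Set.mem_ofPred_eq, this]
      exact le_of_lt hω
  calc P.real {ω | c < |∑ i ∈ b, Y i ω|}
      ≤ P.real (⋃ i ∈ b, {ω | c < |Y i ω|}) + P.real {ω | c ≤ |∑ i ∈ b, τ (Y i ω)|} :=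
        (measureReal_mono hsub).trans (measureReal_union_le _ _)
    _ ≤ ∑ i ∈ b, M / c ^ (1 + a) + b.card * (M / c ^ (1 + a)) :=
        add_le_add ((measureReal_biUnion_finset_le _ _).trans (Finset.sum_le_sum h1)) h2
    _ = 2 * b.card * (M / c ^ (1 + a)) := by
        rw [Finset.sum_const, nsmul_eq_mul]; ring

/-- If each of `k` independent events has probability at most `q`, then at least half of them occur
with probability at most `(4 q) ^ (k / 2)`. -/
theorem measure_half_le {k : ℕ} (B : Fin k → Set Ω) (hB : iIndepSet B P)
    {q : ℝ} (hq : ∀ l, P.real (B l) ≤ q) (hq1 : 4 * q ≤ Real.exp (-2)) :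
    open Classical in
    P.real {ω | k ≤ 2 * (Finset.univ.filter fun l => ω ∈ B l).card} ≤ Real.exp (-k) := by
  classical
  rcases Nat.eq_zero_or_pos k with rfl | hk
  · simp
  have hq0 : 0 ≤ q := measureReal_nonneg.trans (hq ⟨0, hk⟩)
  set e := Real.exp (-2)
  have he1 : e ≤ 1 := Real.exp_le_one_iff.2 (by norm_num)
  -- Union bound over all index sets of size at least `k/2`. There are at most `2^k` of them, and
  -- each contributes at most `exp (-k) / 2^k`.
  have hsub : {ω | k ≤ 2 * (Finset.univ.filter fun l => ω ∈ B l).card} ⊆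
      ⋃ S ∈ Finset.univ.filter fun S : Finset (Fin k) => k ≤ 2 * S.card, ⋂ l ∈ S, B l := by
    intro ω hω
    simp only [Set.mem_iUnion, Set.mem_iInter]
    exact ⟨Finset.univ.filter fun l => ω ∈ B l, by simpa using hω, fun l hl => (Finset.mem_filter.1 hl).2⟩
  have hS : ∀ S ∈ Finset.univ.filter fun S : Finset (Fin k) => k ≤ 2 * S.card,
      P.real (⋂ l ∈ S, B l) ≤ Real.exp (-k) / 2 ^ k := by
    intro S hS
    have hcard : k ≤ 2 * S.card := (Finset.mem_filter.1 hS).2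
    have h1 : P.real (⋂ l ∈ S, B l) ≤ (e / 4) ^ S.card := by
      rw [measureReal_def, hB.meas_biInter S, ENNReal.toReal_prod, ← Finset.prod_const]
      exact Finset.prod_le_prod (fun _ _ => ENNReal.toReal_nonneg) fun l _ =>
        (hq l).trans (by linarith)
    refine h1.trans ?_
    have h2 : (e / 4) = (Real.exp (-1) / 2) ^ 2 := by
      rw [div_pow, ← Real.exp_nat_mul]; norm_num [e]
    have h3 : Real.exp (-k) / 2 ^ k = (Real.exp (-1) / 2) ^ k := by
      rw [div_pow, ← Real.exp_nat_mul]; norm_num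
    rw [h2, h3, ← pow_mul]
    have h4 : Real.exp (-1) ≤ 1 := Real.exp_le_one_iff.2 (by norm_num)
    exact pow_le_pow_of_le_one (by positivity) (by linarith) hcard
  calc _ ≤ ∑ S ∈ Finset.univ.filter fun S : Finset (Fin k) => k ≤ 2 * S.card, P.real (⋂ l ∈ S, B l) :=
        (measureReal_mono hsub (measure_ne_top _ _)).trans (measureReal_biUnion_finset_le _ _)
    _ ≤ (Finset.univ.filter fun S : Finset (Fin k) => k ≤ 2 * S.card).card • (Real.exp (-k) / 2 ^ k) :=
        Finset.sum_le_card_nsmul _ _ _ hS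
    _ ≤ (2 ^ k) * (Real.exp (-k) / 2 ^ k) := by
        rw [nsmul_eq_mul]
        refine mul_le_mul_of_nonneg_right ?_ (by positivity)
        have := Finset.card_filter_le (Finset.univ : Finset (Finset (Fin k))) fun S => k ≤ 2 * S.card
        rw [Finset.card_univ, Fintype.card_finset, Fintype.card_fin] at this
        exact_mod_cast this
    _ = Real.exp (-k) := by field_simp

end Tail

/-! ### Concentration of the perturbed samples -/

theorem map_neg_rademacher : rademacher.map (fun y => -y) = rademacher := by
  rw [rademacher, Measure.map_add _ _ measurable_neg, Measure.map_smul, Measure.map_smul,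
    Measure.map_dirac' measurable_neg, Measure.map_dirac' measurable_neg, neg_neg, add_comm]

theorem integrable_rademacher (f : ℝ → ℝ) : Integrable f rademacher :=
  ((integrable_dirac (by simp)).smul_measure (by simp)).add_measure
    ((integrable_dirac (by simp)).smul_measure (by simp))

theorem integral_rademacher (f : ℝ → ℝ) : ∫ y, f y ∂rademacher = (f 1 + f (-1)) / 2 := by
  rw [rademacher, integral_add_measure ((integrable_dirac (by simp)).smul_measure (by simp))
    ((integrable_dirac (by simp)).smul_measure (by simp)), integral_smul_measure,
    integral_smul_measure, integral_dirac, integral_dirac]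
  simp
  ring

/-- Given the sign, the product is `y` or `-y`, and both have law `ρ`. Thus every perturbed sample
obeys the same tail bound as the original one. -/
theorem map_mul_rademacher_prod {ρ : Measure ℝ} [IsProbabilityMeasure ρ]
    (hρ : ρ.map (fun y => -y) = ρ) :
    (rademacher.prod ρ).map (fun p => p.1 * p.2) = ρ := by
  have hm : Measurable fun p : ℝ × ℝ => p.1 * p.2 := by fun_prop
  have h1 : ((fun p : ℝ × ℝ => p.1 * p.2) ∘ Prod.mk 1) = id := by funext y; simp
  have h2 : ((fun p : ℝ × ℝ => p.1 * p.2) ∘ Prod.mk (-1)) = fun y => -y := by funext y; simp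
  rw [rademacher, Measure.add_prod, Measure.prod_smul_left, Measure.prod_smul_left,
    Measure.dirac_prod, Measure.dirac_prod, Measure.map_add _ _ hm, Measure.map_smul,
    Measure.map_smul, Measure.map_map hm (by fun_prop), Measure.map_map hm (by fun_prop), h1, h2, hρ,
    Measure.map_id, ← add_smul, ENNReal.inv_two_add_inv_two, one_smul]

namespace IsRandomInput

variable {Ω : Type*} [MeasurableSpace Ω] {P : Measure Ω} {K : ℕ} {ν : Fin K → Measure ℝ}
  {ξ : (c : Source K) → Ω → c.Value} [IsProbabilityMeasure P]

/-- The perturbed sample in terms of the random inputs. -/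
def perturbedInput (ξ : (c : Source K) → Ω → c.Value) (t : ℕ) (i : Fin K) (c : ℝ) (j r : ℕ)
    (ω : Ω) : ℝ :=
  perturbed (fun s => rewardInput ξ i s ω) (fun s l => signInput ξ t i s l ω) c j r

theorem measurable_perturbedInput_iSup (t : ℕ) (i : Fin K) (c : ℝ) (j r : ℕ) {S : Set (Source K)}
    (h1 : Source.reward i r ∈ S) (h2 : Source.sign t i r j ∈ S) :
    Measurable[⨆ c ∈ S, MeasurableSpace.comap (ξ c) inferInstance] (perturbedInput ξ t i c j r) := by
  have hr : Measurable[⨆ c ∈ S, MeasurableSpace.comap (ξ c) inferInstance] (rewardInput ξ i r) :=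
    measurable_comap_iSup ξ h1
  have hs : Measurable[⨆ c ∈ S, MeasurableSpace.comap (ξ c) inferInstance] (signInput ξ t i r j) :=
    measurable_comap_iSup ξ h2
  unfold perturbedInput perturbed
  split_ifs
  · exact @Measurable.sub_const _ _ _ _ _ (_) _ hr c
  · exact @Measurable.mul _ _ _ _ _ (_) _ _ hs (@Measurable.sub_const _ _ _ _ _ (_) _ hr c)

theorem measurable_perturbedInput (h : IsRandomInput P ν ξ) (t : ℕ) (i : Fin K) (c : ℝ) (j r : ℕ) :
    Measurable (perturbedInput ξ t i c j r) :=
  (measurable_perturbedInput_iSup t i c j r (Set.mem_univ _) (Set.mem_univ _)).mono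
    (iSup₂_le fun c _ => h.comap_le c) le_rfl

theorem map_perturbedInput (h : IsRandomInput P ν ξ) {i : Fin K} [IsProbabilityMeasure (ν i)] {c : ℝ}
    (hsymm : SymmetricAbout (ν i) c) (t j r : ℕ) :
    P.map (perturbedInput ξ t i c j r) = (ν i).map (fun y => y - c) := by
  have : IsProbabilityMeasure ((ν i).map fun y => y - c) :=
    Measure.isProbabilityMeasure_map (by fun_prop)
  have hm : Measurable fun y : ℝ => y - c := by fun_prop
  have hcent : P.map (fun ω => rewardInput ξ i r ω - c) = (ν i).map (fun y => y - c) := by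
    rw [← h.map_reward i r, Measure.map_map hm (h.measurable_reward i r)]
    rfl
  by_cases hj : j = 0
  · rw [← hcent]
    congr 1
    funext ω
    simp [perturbedInput, perturbed, hj]
  · have hind : IndepFun (signInput ξ t i r j) (fun ω => rewardInput ξ i r ω - c) P := by
      have := h.indep.indepFun (i := Source.sign t i r j) (j := Source.reward i r) (by simp)
      exact IndepFun.comp (φ := id) (ψ := fun y : ℝ => y - c) this measurable_id hm
    have hpair := (indepFun_iff_map_prod_eq_prod_map_map (h.measurable_sign t i r j).aemeasurable
      ((h.measurable_reward i r).sub_const c).aemeasurable).1 hind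
    rw [hcent, h.map_sign] at hpair
    rw [← map_mul_rademacher_prod (symmetricAbout_map_sub hsymm), ← hpair,
      Measure.map_map (by fun_prop) ((h.measurable_sign t i r j).prodMk
        ((h.measurable_reward i r).sub_const c))]
    congr 1
    funext ω
    simp [perturbedInput, perturbed, hj]

theorem iIndepFun_perturbedInput (h : IsRandomInput P ν ξ) (t : ℕ) (i : Fin K) (c : ℝ) (j : ℕ) :
    iIndepFun (fun r => perturbedInput ξ t i c j r) P := by
  refine iIndepFun_of_measurable_iSup h.comap_le h.iIndep_comap
    (S := fun r => {Source.reward i r, Source.sign t i r j}) ?_ fun r =>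
      measurable_perturbedInput_iSup t i c j r (by simp) (by simp)
  intro r r' hr
  refine Set.disjoint_left.2 ?_
  rintro _ (rfl | rfl) (h' | h') <;> simp at h' <;> exact hr h'

theorem iIndepFun_signInput (h : IsRandomInput P ν ξ) (t : ℕ) (i : Fin K) (j : ℕ) :
    iIndepFun (fun r => signInput ξ t i r j) P :=
  h.indep.precomp (g := fun r => Source.sign t i r j) fun r r' hr => by simpa using hr

/-- The event that the `l`-th block is bad. -/
def badBlock (ξ : (c : Source K) → Ω → c.Value) (t : ℕ) (i : Fin K) (c : ℝ) (j n k l : ℕ) (η : ℝ) :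
    Set Ω :=
  {ω | η < |blockAvg n k l (fun r => perturbedInput ξ t i c j r ω)| ∨
    1 / 2 < blockAvg n k l fun r => signInput ξ t i r j ω}

/-- The two terms are the truncated Chebyshev bound for the noise and for the signs. -/
theorem measureReal_badBlock_le (h : IsRandomInput P ν ξ) {i : Fin K} [IsProbabilityMeasure (ν i)]
    {c : ℝ} (hsymm : SymmetricAbout (ν i) c) {a M η : ℝ} (ha0 : 0 < a) (ha1 : a ≤ 1)
    (hint : Integrable (fun y => |y - c| ^ (1 + a)) (ν i)) (hM : ∫ y, |y - c| ^ (1 + a) ∂ν i = M)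
    (hη : 0 < η) (t j : ℕ) {n k l : ℕ} (hB : 0 < (block n k l).card) :
    P.real (badBlock ξ t i c j n k l η) ≤
      2 * M / (η ^ (1 + a) * ((block n k l).card : ℝ) ^ a) + 8 / (block n k l).card := by
  have : IsProbabilityMeasure ((ν i).map fun y => y - c) :=
    Measure.isProbabilityMeasure_map (by fun_prop)
  set b := block n k l
  have hb : (0 : ℝ) < b.card := by exact_mod_cast hB
  have hm : AEMeasurable (fun y : ℝ => y - c) (ν i) := by fun_prop
  have hpm : Measurable fun y : ℝ => |y| ^ (1 + a) := by fun_prop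
  have t1 := measure_lt_abs_sum_le (P := P) b (fun r => perturbedInput ξ t i c j r)
    (h.measurable_perturbedInput t i c j)
    (fun r _ r' _ hr => (h.iIndepFun_perturbedInput t i c j).indepFun hr)
    (symmetricAbout_map_sub hsymm) (fun r _ => h.map_perturbedInput hsymm t j r) ha0 ha1
    ((integrable_map_measure hpm.aestronglyMeasurable hm).2 hint)
    ((integral_map hm hpm.aestronglyMeasurable).trans hM) (mul_pos hη hb)
  -- Signs have second moment `1`; with `a = 1` and deviation `B/2` for a block of size `B`, the
  -- bound is `2B / (B/2)² = 8/B`.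
  have t2 := measure_lt_abs_sum_le (P := P) b (fun r => signInput ξ t i r j)
    (fun r => h.measurable_sign t i r j)
    (fun r _ r' _ hr => (h.iIndepFun_signInput t i j).indepFun hr)
    map_neg_rademacher (fun r _ => h.map_sign t i r j) one_pos le_rfl (M := 1)
    (integrable_rademacher _) (by rw [integral_rademacher]; norm_num) (half_pos hb)
  have hsub : badBlock ξ t i c j n k l η ⊆
      {ω | η * b.card < |∑ r ∈ b, perturbedInput ξ t i c j r ω|} ∪
        {ω | (b.card : ℝ) / 2 < |∑ r ∈ b, signInput ξ t i r j ω|} := by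
    rintro ω (hω | hω)
    · left
      rwa [blockAvg, abs_div, abs_of_pos hb, lt_div_iff₀ hb] at hω
    · right
      rw [blockAvg, lt_div_iff₀ hb] at hω
      have := le_abs_self (∑ r ∈ b, signInput ξ t i r j ω)
      simp only [Set.mem_ofPred_eq]
      linarith
  refine (measureReal_mono hsub).trans ((measureReal_union_le _ _).trans
    (add_le_add (t1.trans (le_of_eq ?_)) (t2.trans (le_of_eq ?_))))
  · rw [Real.mul_rpow hη.le hb.le, Real.rpow_add hb, Real.rpow_one]
    have : 0 < η ^ (1 + a) := Real.rpow_pos_of_pos hη _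
    have : 0 < (b.card : ℝ) ^ a := Real.rpow_pos_of_pos hb _
    field_simp
  · norm_num
    field_simp
    norm_num

/-- Distinct blocks use disjoint sets of rewards and signs. -/
theorem iIndepSet_badBlock (h : IsRandomInput P ν ξ) (t : ℕ) (i : Fin K) (c : ℝ) (j n k : ℕ) (η : ℝ) :
    iIndepSet (fun l : Fin k => badBlock ξ t i c j n k l η) P := by
  let S : Fin k → Set (Source K) := fun l =>
    {s | ∃ r ∈ block n k l, s = .reward i r ∨ s = .sign t i r j}
  have hS : ∀ l l', l ≠ l' → Disjoint (S l) (S l') := by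
    intro l l' hl
    refine Set.disjoint_left.2 ?_
    rintro _ ⟨r, hr, h1⟩ ⟨r', hr', h2⟩
    have hrr : r = r' := by rcases h1 with rfl | rfl <;> simpa using h2
    subst hrr
    exact Finset.disjoint_left.1 (pairwiseDisjoint_block n k Set.univ (Set.mem_univ _)
      (Set.mem_univ _) fun he => hl (Fin.ext he)) hr hr'
  have hind := iIndep_iSup_of_disjoint h.comap_le h.iIndep_comap hS
  have hmeas (l : Fin k) : MeasurableSet[⨆ c ∈ S l, MeasurableSpace.comap (ξ c) inferInstance]
      (badBlock ξ t i c j n k l η) := by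
    have h1 : Measurable[⨆ c ∈ S l, MeasurableSpace.comap (ξ c) inferInstance] fun ω =>
        blockAvg n k l fun r => perturbedInput ξ t i c j r ω := by
      refine @Measurable.div_const _ _ _ _ _ (_) _ ?_ _
      exact @Finset.measurable_sum _ _ _ _ _ _ (_) _ _ fun r hr =>
        measurable_perturbedInput_iSup t i c j r ⟨r, hr, Or.inl rfl⟩ ⟨r, hr, Or.inr rfl⟩
    have h2 : Measurable[⨆ c ∈ S l, MeasurableSpace.comap (ξ c) inferInstance] fun ω =>
        blockAvg n k l fun r => signInput ξ t i r j ω := by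
      refine @Measurable.div_const _ _ _ _ _ (_) _ ?_ _
      exact @Finset.measurable_sum _ _ _ _ _ _ (_) _ _ fun r hr =>
        measurable_comap_iSup ξ (i := Source.sign t i r j) ⟨r, hr, Or.inr rfl⟩
    have e1 : MeasurableSet {y : ℝ | η < |y|} := measurableSet_lt measurable_const measurable_id.abs
    exact MeasurableSet.union (h1 e1) (h2 measurableSet_Ioi)
  have hle (l : Fin k) : (⨆ c ∈ S l, MeasurableSpace.comap (ξ c) inferInstance) ≤
      ‹MeasurableSpace Ω› := iSup₂_le fun c _ => h.comap_le c
  rw [iIndepSet_iff_meas_biInter fun l => hle l _ (hmeas l)]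
  intro s
  exact (iIndep_iff _ _).1 hind s fun l _ => hmeas l

theorem measureReal_not_fewBadBlocks_le (h : IsRandomInput P ν ξ) {i : Fin K}
    [IsProbabilityMeasure (ν i)] {c : ℝ} (hsymm : SymmetricAbout (ν i) c) {a M η q : ℝ} (ha0 : 0 < a)
    (ha1 : a ≤ 1) (hint : Integrable (fun y => |y - c| ^ (1 + a)) (ν i))
    (hM : ∫ y, |y - c| ^ (1 + a) ∂ν i = M) (hη : 0 < η) (t j : ℕ) {n k : ℕ} (hkn : k ≤ n)
    (hq : ∀ l < k, 2 * M / (η ^ (1 + a) * ((block n k l).card : ℝ) ^ a) +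
      8 / (block n k l).card ≤ q) (hq1 : 4 * q ≤ Real.exp (-2)) :
    P.real {ω | ¬ FewBadBlocks n k (fun r => perturbedInput ξ t i c j r ω)
      (fun r => signInput ξ t i r j ω) η} ≤ Real.exp (-k) := by
  refine le_trans (le_of_eq ?_) (measure_half_le (P := P) _ (h.iIndepSet_badBlock t i c j n k η)
    (fun l => (h.measureReal_badBlock_le hsymm ha0 ha1 hint hM hη t j
      (card_block_pos l.2 hkn)).trans (hq l l.2)) hq1)
  congr 1
  ext ω
  simp only [FewBadBlocks, Set.mem_ofPred_eq, not_lt]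
  congr! 2
  refine congrArg Finset.card ?_
  ext l
  simp [badBlock]

end IsRandomInput

/-! ### Sample sizes that guarantee concentration -/

theorem one_le_momentConst {a : ℝ} (ha : 0 < a) : 1 ≤ momentConst a :=
  one_le_mul_of_one_le_of_one_le (Real.one_le_rpow (by norm_num) (by positivity))
    (Real.one_le_rpow (by norm_num) (by positivity))

/-- Every sample size above a quarter of `sizeConst * log t ^ 2` guarantees concentration. -/
noncomputable def sizeConst (a ρ : ℝ) : ℝ := max (momentConst a * ρ ^ (1 / a)) (17 ^ 2)

theorem sizeConst_ge (a ρ : ℝ) : 289 ≤ sizeConst a ρ := by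
  refine le_trans ?_ (le_max_right _ _)
  norm_num

/-- The threshold for `t` depends on `a` alone and is uniform in `s`, `Δ` and `M`; therefore the
additive regret constant sees the distributions only through the displayed ratio. Fixed numerical
factors are beaten by `log t → ∞`, so `1 ≤ momentConst a` is all that is used about that constant.
-/
theorem eventually_blocks_suffice {a : ℝ} (ha0 : 0 < a) (ha1 : a ≤ 1) :
    ∀ᶠ t : ℕ in atTop, ∀ (s : ℕ) (Δ M : ℝ), 0 < Δ → 0 ≤ M →
      sizeConst a (M / Δ ^ (1 + a)) * Real.log t ^ 2 / 4 ≤ s →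
      numBlocks t s ≤ s ∧
      (∀ B : ℕ, s / numBlocks t s ≤ B →
        2 * M / ((Δ / 16) ^ (1 + a) * (B : ℝ) ^ a) + 8 / B ≤ Real.exp (-2) / 4) ∧
      Real.exp (-(numBlocks t s : ℝ)) ≤ 1 / (t : ℝ) ^ 8 := by
  have hlog : Tendsto (fun t : ℕ => Real.log t) atTop atTop :=
    Real.tendsto_log_atTop.comp tendsto_natCast_atTop_atTop
  have h1 : Tendsto (fun t : ℕ => 2 * 256 / (Real.log t / 136) ^ a) atTop (nhds 0) :=
    ((tendsto_rpow_atTop ha0).comp (hlog.atTop_div_const (by norm_num))).const_div_atTop _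
  have h2 : Tendsto (fun t : ℕ => 8 / Real.log t) atTop (nhds 0) := hlog.const_div_atTop _
  have he : 0 < Real.exp (-2) / 8 := by positivity
  filter_upwards [hlog.eventually_ge_atTop 2, h1.eventually_le_const he, h2.eventually_le_const he,
    eventually_ge_atTop 1] with t hL e1 e2 ht s Δ M hΔ hM hs
  set L := Real.log t
  set ρ := M / Δ ^ (1 + a)
  set D := sizeConst a ρ
  have hD : 289 ≤ D := sizeConst_ge a ρ
  have hρ0 : 0 ≤ ρ := by positivity
  have hDρ : ρ ^ (1 / a) ≤ D :=
    (le_mul_of_one_le_left (by positivity) (one_le_momentConst ha0)).trans (le_max_left _ _)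
  -- The entry `17²` of the maximum gives `√s ≥ 8.5 L`. So `k ≥ 8.5 L - 1 ≥ 8 L` as `L ≥ 2`, and
  -- `exp (-k) ≤ t⁻⁸`.
  have hs289 : (17 / 2 * L) ^ 2 ≤ s := by nlinarith [sq_nonneg L]
  have hsqrt : 17 / 2 * L ≤ Real.sqrt s := Real.le_sqrt_of_sq_le hs289
  have hmin : 17 / 2 * L ≤ min (17 * L) (Real.sqrt s) := le_min (by linarith) hsqrt
  have hk1 : 8 * L ≤ numBlocks t s := by
    have := Nat.lt_floor_add_one (min (17 * L) (Real.sqrt s))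
    change _ < (numBlocks t s : ℝ) + 1 at this
    linarith
  have hk2 : (numBlocks t s : ℝ) ≤ min (17 * L) (Real.sqrt s) :=
    Nat.floor_le (le_trans (by linarith) hmin)
  have hk3 : (numBlocks t s : ℝ) ≤ 17 * L := hk2.trans (min_le_left _ _)
  have hk0 : (0 : ℝ) < numBlocks t s := by linarith
  have hs1 : (1 : ℝ) ≤ s := by nlinarith
  refine ⟨?_, fun B hB => ?_, ?_⟩
  · have h3 : (numBlocks t s : ℝ) ≤ s := by
      refine (hk2.trans (min_le_right _ _)).trans (Real.sqrt_le_iff.2 ⟨by linarith, ?_⟩)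
      nlinarith
    exact_mod_cast h3
  · have hBs : (s : ℝ) / numBlocks t s - 1 ≤ B := by
      have h3 := Nat.lt_floor_add_one ((s : ℝ) / numBlocks t s)
      rw [Nat.floor_div_eq_div] at h3
      have h4 : ((s / numBlocks t s : ℕ) : ℝ) ≤ B := by exact_mod_cast hB
      linarith
    -- From `s ≥ D L² / 4` and `k ≤ 17 L` one gets `s / k ≥ D L / 68`; half of this pays for the
    -- rounding of the block size.
    have hBD : D * (L / 136) ≤ B := by
      refine le_trans ?_ hBs
      have h3 : D * (L / 68) ≤ s / numBlocks t s := by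
        rw [le_div_iff₀ hk0]
        have h4 : 0 ≤ D * (L / 68) := by positivity
        nlinarith
      nlinarith
    have hBL : L ≤ B := by nlinarith
    have hB0 : (0 : ℝ) < B := by linarith
    -- As `D ≥ ρ^(1/a)`, the ratio `ρ = M / Δ^(1+a)` cancels, and the noise term is bounded by a
    -- function of `t` and `a` only.
    have hBa : ρ * (L / 136) ^ a ≤ (B : ℝ) ^ a := by
      have h3 : ρ * (L / 136) ^ a = (ρ ^ (1 / a) * (L / 136)) ^ a := by
        rw [Real.mul_rpow (by positivity) (by positivity), ← Real.rpow_mul hρ0,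
          one_div_mul_cancel ha0.ne', Real.rpow_one]
      rw [h3]
      refine Real.rpow_le_rpow (by positivity) (le_trans ?_ hBD) ha0.le
      exact mul_le_mul_of_nonneg_right hDρ (by positivity)
    have hBa0 : 0 < (B : ℝ) ^ a := Real.rpow_pos_of_pos hB0 _
    have hLa : 0 < (L / 136) ^ a := Real.rpow_pos_of_pos (by positivity) _
    have hΔa : 0 < Δ ^ (1 + a) := Real.rpow_pos_of_pos hΔ _
    have h16 : (16 : ℝ) ^ (1 + a) ≤ 256 := by
      calc (16 : ℝ) ^ (1 + a) ≤ 16 ^ (2 : ℝ) :=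
            Real.rpow_le_rpow_of_exponent_le (by norm_num) (by linarith)
        _ = 256 := by norm_num
    have hfirst : 2 * M / ((Δ / 16) ^ (1 + a) * (B : ℝ) ^ a) ≤ 2 * 256 / (L / 136) ^ a := by
      rw [Real.div_rpow hΔ.le (by norm_num)]
      have h160 : 0 < (16 : ℝ) ^ (1 + a) := by positivity
      have h5 : 2 * M / (Δ ^ (1 + a) / 16 ^ (1 + a) * (B : ℝ) ^ a) =
          2 * 16 ^ (1 + a) * (ρ / (B : ℝ) ^ a) := by
        simp only [ρ]
        field_simp
      rw [h5, mul_div_assoc]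
      have h6 : ρ / (B : ℝ) ^ a ≤ 1 / (L / 136) ^ a := by
        rw [div_le_div_iff₀ hBa0 hLa, one_mul]
        exact hBa
      have h7 : 0 ≤ ρ / (B : ℝ) ^ a := by positivity
      calc 2 * 16 ^ (1 + a) * (ρ / (B : ℝ) ^ a) ≤ 2 * 256 * (1 / (L / 136) ^ a) := by gcongr
        _ = 2 * (256 / (L / 136) ^ a) := by ring
    have hsecond : 8 / (B : ℝ) ≤ 8 / L := by gcongr
    linarith
  · have ht0 : (0 : ℝ) < t := by exact_mod_cast ht
    rw [one_div, ← Real.exp_log (pow_pos ht0 8), ← Real.exp_neg, Real.log_pow]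
    refine Real.exp_le_exp.2 ?_
    push_cast
    linarith

/-! ### Bounds on the events of one round -/

namespace IsRandomInput

variable {Ω : Type*} [MeasurableSpace Ω] {P : Measure Ω} {K : ℕ} {ν : Fin K → Measure ℝ}
  {ξ : (c : Source K) → Ω → c.Value} [IsProbabilityMeasure P]

/-- The upper confidence bound as a random variable. -/
noncomputable def ucbInput (ξ : (c : Source K) → Ω → c.Value) (t : ℕ) (i : Fin K) (s : ℕ) (ω : Ω) :
    EReal :=
  armUCB (fun c => ξ c ω) t i s

/-- Good event for the `j`-th perturbed sample. -/
def good (ξ : (c : Source K) → Ω → c.Value) (t : ℕ) (i : Fin K) (c η : ℝ) (s j : ℕ) : Set Ω :=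
  {ω | FewBadBlocks s (numBlocks t s) (fun r => perturbedInput ξ t i c j r ω)
    (fun r => signInput ξ t i r j ω) η}

/-- If the bound is below the mean, the mean is rejected, that is, the original sample comes first
at the true mean. -/
theorem measureReal_ucb_lt_mean (h : IsRandomInput P ν ξ) {i : Fin K} [IsProbabilityMeasure (ν i)]
    (hsymm : SymmetricAbout (ν i) (mean (ν i))) (t s : ℕ) :
    P.real {ω | ucbInput ξ t i s ω < (mean (ν i) : EReal)} ≤ 1 / levelDen t := by
  have hsub : {ω | ucbInput ξ t i s ω < (mean (ν i) : EReal)} ⊆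
      {ω | ∀ j : Fin (levelDen t), j ≠ 0 → Precedes (refVar s (numBlocks t s)
        (fun s => rewardInput ξ i s ω) (fun s j => signInput ξ t i s j ω) (mean (ν i)))
          (permInput ξ t i ω) 0 j} := by
    intro ω hω
    by_contra hno
    exact absurd (coe_le_ucb hno) (not_le.2 hω)
  have := (measure_mono hsub).trans (h.measure_forall_precedes_le hsymm t s (numBlocks t s))
  rw [measureReal_def, one_div, ← ENNReal.toReal_natCast, ← ENNReal.toReal_inv]
  exact ENNReal.toReal_mono (by simp [NeZero.ne]) this

theorem measureReal_compl_good_le (h : IsRandomInput P ν ξ) {a : ℝ} {t : ℕ} {s : ℕ} {Δ : ℝ}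
    {i : Fin K} [IsProbabilityMeasure (ν i)]
    (hsymm : SymmetricAbout (ν i) (mean (ν i))) (ha0 : 0 < a) (ha1 : a ≤ 1)
    (hint : FiniteAbsMoment (ν i) a) (hΔ : 0 < Δ)
    (hks : numBlocks t s ≤ s)
    (hB : ∀ B : ℕ, s / numBlocks t s ≤ B →
        2 * absMoment (ν i) a / ((Δ / 16) ^ (1 + a) * (B : ℝ) ^ a) + 8 / B ≤ Real.exp (-2) / 4)
    (hexp : Real.exp (-(numBlocks t s : ℝ)) ≤ 1 / (t : ℝ) ^ 8) (j : ℕ) :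
    P.real (good ξ t i (mean (ν i)) (Δ / 16) s j)ᶜ ≤ 1 / (t : ℝ) ^ 8 :=
  (h.measureReal_not_fewBadBlocks_le hsymm ha0 ha1 hint rfl (by positivity) t j hks
    (fun _ hl => hB _ (card_block_ge hl)) (by linarith)).trans hexp

/-- With `η = Δ/16`, good blocks in all `levelDen t` samples give a bound of at most `μ + Δ/4`. -/
theorem measureReal_mean_add_le_ucb (h : IsRandomInput P ν ξ) {a : ℝ} {t : ℕ} {s : ℕ} {Δ : ℝ}
    {i : Fin K} [IsProbabilityMeasure (ν i)]
    (hsymm : SymmetricAbout (ν i) (mean (ν i))) (ha0 : 0 < a) (ha1 : a ≤ 1)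
    (hint : FiniteAbsMoment (ν i) a) (hΔ : 0 < Δ)
    (hks : numBlocks t s ≤ s)
    (hB : ∀ B : ℕ, s / numBlocks t s ≤ B →
        2 * absMoment (ν i) a / ((Δ / 16) ^ (1 + a) * (B : ℝ) ^ a) + 8 / B ≤ Real.exp (-2) / 4)
    (hexp : Real.exp (-(numBlocks t s : ℝ)) ≤ 1 / (t : ℝ) ^ 8) :
    P.real {ω | ((mean (ν i) + Δ / 2 : ℝ) : EReal) ≤ ucbInput ξ t i s ω} ≤
      levelDen t * (1 / (t : ℝ) ^ 8) := by
  have hsub : {ω | ((mean (ν i) + Δ / 2 : ℝ) : EReal) ≤ ucbInput ξ t i s ω} ⊆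
      ⋃ j : Fin (levelDen t), (good ξ t i (mean (ν i)) (Δ / 16) s j)ᶜ := by
    intro ω hω
    by_contra hno
    simp only [Set.mem_iUnion, Set.mem_compl_iff, not_exists, not_not] at hno
    have h1 : ucbInput ξ t i s ω ≤ ((mean (ν i) + 4 * (Δ / 16) : ℝ) : EReal) :=
      ucb_le_of_fewBadBlocks hks hno
    have := EReal.coe_le_coe_iff.1 (le_trans hω h1)
    linarith
  refine (measureReal_mono hsub).trans ((measureReal_iUnion_fintype_le _).trans ?_)
  refine (Finset.sum_le_card_nsmul _ _ _ fun (j : Fin (levelDen t)) _ =>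
    h.measureReal_compl_good_le hsymm ha0 ha1 hint hΔ hks hB hexp j).trans ?_
  simp

theorem measureReal_ucb_lt_mean_sub (h : IsRandomInput P ν ξ) {a : ℝ} {t : ℕ} {s : ℕ} {Δ : ℝ}
    {i : Fin K} [IsProbabilityMeasure (ν i)]
    (hsymm : SymmetricAbout (ν i) (mean (ν i))) (ha0 : 0 < a) (ha1 : a ≤ 1)
    (hint : FiniteAbsMoment (ν i) a) (hΔ : 0 < Δ) (ht : 2 ≤ levelDen t)
    (hks : numBlocks t s ≤ s)
    (hB : ∀ B : ℕ, s / numBlocks t s ≤ B →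
        2 * absMoment (ν i) a / ((Δ / 16) ^ (1 + a) * (B : ℝ) ^ a) + 8 / B ≤ Real.exp (-2) / 4)
    (hexp : Real.exp (-(numBlocks t s : ℝ)) ≤ 1 / (t : ℝ) ^ 8) :
    P.real {ω | ucbInput ξ t i s ω < ((mean (ν i) - Δ / 2 : ℝ) : EReal)} ≤ 2 * (1 / (t : ℝ) ^ 8) := by
  have hsub : {ω | ucbInput ξ t i s ω < ((mean (ν i) - Δ / 2 : ℝ) : EReal)} ⊆
      (good ξ t i (mean (ν i)) (Δ / 16) s 0)ᶜ ∪ (good ξ t i (mean (ν i)) (Δ / 16) s 1)ᶜ := by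
    intro ω hω
    by_contra hno
    simp only [Set.mem_union, Set.mem_compl_iff, not_or, not_not] at hno
    have h1 : ((mean (ν i) - Δ / 2 : ℝ) : EReal) ≤ ucbInput ξ t i s ω :=
      coe_le_ucb_of_fewBadBlocks hks ht (by positivity) hno.1 hno.2 (by linarith)
    exact absurd h1 (not_le.2 hω)
  refine (measureReal_mono hsub).trans ((measureReal_union_le _ _).trans ?_)
  linarith [h.measureReal_compl_good_le hsymm ha0 ha1 hint hΔ hks hB hexp 0,
    h.measureReal_compl_good_le hsymm ha0 ha1 hint hΔ hks hB hexp 1]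

end IsRandomInput

/-! ### Regret decomposition -/

theorem integrable_id_of_finiteAbsMoment {ν : Measure ℝ} [IsProbabilityMeasure ν] {a : ℝ} (ha : 0 < a)
    (h : FiniteAbsMoment ν a) : Integrable (fun y => y) ν := by
  have h1 : Integrable (fun y => 1 + |mean ν| + |y - mean ν| ^ (1 + a)) ν :=
    (integrable_const _).add h
  refine h1.mono' measurable_id.aestronglyMeasurable (ae_of_all _ fun y => ?_)
  rw [Real.norm_eq_abs]
  have h2 : |y| ≤ |y - mean ν| + |mean ν| := by
    simpa using abs_add_le (y - mean ν) (mean ν)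
  have h3 : |y - mean ν| ≤ 1 + |y - mean ν| ^ (1 + a) := by
    rcases le_total |y - mean ν| 1 with h | h
    · have : 0 ≤ |y - mean ν| ^ (1 + a) := by positivity
      linarith
    · have := Real.rpow_le_rpow_of_exponent_le h (show (1 : ℝ) ≤ 1 + a by linarith)
      rw [Real.rpow_one] at this
      linarith
  linarith

/-- A function of an independent family that does not depend on one of the members is independent
of this member. -/
theorem _root_.ProbabilityTheory.iIndepFun.indepFun_of_congr {Ω ι γ : Type*} [MeasurableSpace Ω]
    {P : Measure Ω} {β : ι → Type*} [∀ i, MeasurableSpace (β i)] [MeasurableSpace γ]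
    {ξ : ∀ i, Ω → β i} (h : iIndepFun ξ P) (hm : ∀ i, Measurable (ξ i)) {c₀ : ι} (v₀ : β c₀)
    {f : (∀ i, β i) → γ} (hf : Measurable f)
    (hcongr : ∀ x x' : ∀ i, β i, (∀ c, c ≠ c₀ → x c = x' c) → f x = f x') :
    IndepFun (fun ω => f fun c => ξ c ω) (ξ c₀) P := by
  classical
  -- Freezing the coordinate `c₀` at `v₀` does not change the value and shows measurability with
  -- respect to the other members.
  have hfeq : (fun ω => f fun c => ξ c ω) = fun ω => f (Function.update (fun c => ξ c ω) c₀ v₀) :=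
    funext fun ω => hcongr _ _ fun c hc => by
      rw [Function.update_of_ne hc]
  rw [hfeq]
  have hdisj : Disjoint ({c₀}ᶜ : Set ι) {c₀} := disjoint_compl_left
  refine (IndepFun_iff_Indep _ _ _).2 (indep_of_indep_of_le_left (indep_of_indep_of_le_right
    (indep_iSup_of_disjoint (fun c => (hm c).comap_le) h.iIndep hdisj) ?_) ?_)
  · exact Measurable.comap_le (measurable_comap_iSup ξ (S := {c₀}) (i := c₀) rfl)
  · refine Measurable.comap_le (hf.comp (@measurable_pi_lambda _ _ _ (_) _ _ fun c => ?_))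
    by_cases hc : c = c₀
    · subst hc
      simp only [Function.update_self]
      exact @measurable_const _ _ (_) (_) _
    · simp only [Function.update_of_ne hc]
      exact measurable_comap_iSup ξ hc

namespace IsRandomInput

variable {Ω : Type*} [MeasurableSpace Ω] {P : Measure Ω} {K : ℕ} {ν : Fin K → Measure ℝ}
  {ξ : (c : Source K) → Ω → c.Value}

theorem measurable_pi (h : IsRandomInput P ν ξ) : Measurable fun ω (c : Source K) => ξ c ω :=
  measurable_pi_lambda _ h.measurable

/-- The set of inputs for which arm `i` is pulled for the `(s + 1)`-st time in round `t`. -/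
def pullSet (tie : ℕ → Finset (Fin K) → Fin K) (t : ℕ) (i : Fin K) (s : ℕ) :
    Set ((c : Source K) → c.Value) :=
  {x | arm tie x t = i ∧ pulls tie x (t - 1) i = s}

theorem measurableSet_pullSet (tie : ℕ → Finset (Fin K) → Fin K) (t : ℕ) (i : Fin K) (s : ℕ) :
    MeasurableSet (pullSet tie t i s) :=
  (measurable_arm tie t (measurableSet_singleton i)).inter
    (((measurable_pi_apply i).comp (measurable_pulls tie (t - 1))) (measurableSet_singleton s))

theorem integrable_rewardInput (h : IsRandomInput P ν ξ) {i : Fin K}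
    (hint : Integrable (fun y => y) (ν i)) (s : ℕ) : Integrable (rewardInput ξ i s) P := by
  rw [← h.map_reward i s] at hint
  exact (integrable_map_measure aestronglyMeasurable_id (h.measurable_reward i s).aemeasurable).1 hint

theorem integral_rewardInput (h : IsRandomInput P ν ξ) (i : Fin K) (s : ℕ) :
    ∫ ω, rewardInput ξ i s ω ∂P = mean (ν i) := by
  rw [mean, ← h.map_reward i s]
  exact (integral_map (h.measurable_reward i s).aemeasurable aestronglyMeasurable_id).symm

/-- Whether arm `i` is pulled for the `(s + 1)`-st time in round `t` is independent of the reward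
obtained in this case. -/
theorem indepFun_pullSet_reward [IsProbabilityMeasure P] (h : IsRandomInput P ν ξ)
    (tie : ℕ → Finset (Fin K) → Fin K) (t : ℕ) (i : Fin K) (s : ℕ) :
    IndepFun (fun ω => (pullSet tie t i s).indicator (fun _ => (1 : ℝ)) fun c => ξ c ω)
      (rewardInput ξ i s) P := by
  refine h.indep.indepFun_of_congr h.measurable (c₀ := .reward i s) (0 : ℝ)
    (measurable_const.indicator (measurableSet_pullSet tie t i s)) fun x x' hx => ?_
  have hiff : x ∈ pullSet tie t i s ↔ x' ∈ pullSet tie t i s := arm_pulls_congr hx t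
  by_cases hx' : x' ∈ pullSet tie t i s
  · rw [Set.indicator_of_mem (hiff.2 hx'), Set.indicator_of_mem hx']
  · rw [Set.indicator_of_notMem (mt hiff.1 hx'), Set.indicator_of_notMem hx']

/-- Splitting by arm and pull count replaces the randomly indexed reward by fixed ones, each
multiplied by an indicator independent of it. -/
theorem roundReward_eq (tie : ℕ → Finset (Fin K) → Fin K) {t : ℕ} (ht : 1 ≤ t) (ω : Ω) :
    roundReward tie (fun c => ξ c ω) t = ∑ i, ∑ s ∈ Finset.range t,
      (pullSet tie t i s).indicator (fun _ => (1 : ℝ)) (fun c => ξ c ω) * rewardInput ξ i s ω := by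
  classical
  set x : (c : Source K) → c.Value := fun c => ξ c ω
  rw [Finset.sum_eq_single (arm tie x t), Finset.sum_eq_single (pulls tie x (t - 1) (arm tie x t))]
  · rw [Set.indicator_of_mem (show x ∈ pullSet tie t _ _ from ⟨rfl, rfl⟩), one_mul]
    rfl
  · intro s _ hs
    rw [Set.indicator_of_notMem (fun h' => hs h'.2.symm), zero_mul]
  · intro hs
    have := pulls_le (tie := tie) x (t - 1) (arm tie x t)
    exact absurd (Finset.mem_range.2 (by omega)) hs
  · intro i _ hi
    refine Finset.sum_eq_zero fun s _ => ?_
    rw [Set.indicator_of_notMem (fun h' => hi h'.1.symm), zero_mul]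
  · simp

theorem integrable_indicator_mul_reward (h : IsRandomInput P ν ξ)
    (tie : ℕ → Finset (Fin K) → Fin K) {i : Fin K} (hint : Integrable (fun y => y) (ν i)) (t s : ℕ) :
    Integrable (fun ω => (pullSet tie t i s).indicator (fun _ => (1 : ℝ)) (fun c => ξ c ω) *
      rewardInput ξ i s ω) P := by
  refine (h.integrable_rewardInput hint s).bdd_mul (c := 1) ?_ (ae_of_all _ fun ω => ?_)
  · exact ((measurable_const.indicator (measurableSet_pullSet tie t i s)).comp
      h.measurable_pi).aestronglyMeasurable
  · unfold Set.indicator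
    split_ifs <;> simp

theorem integrable_roundReward (h : IsRandomInput P ν ξ) (tie : ℕ → Finset (Fin K) → Fin K)
    (hint : ∀ i, Integrable (fun y => y) (ν i)) {t : ℕ} (ht : 1 ≤ t) :
    Integrable (fun ω => roundReward tie (fun c => ξ c ω) t) P := by
  simp only [roundReward_eq tie ht]
  exact integrable_finsetSum _ fun i _ => integrable_finsetSum _ fun s _ =>
    h.integrable_indicator_mul_reward tie (hint i) t s

theorem integrable_totalReward (h : IsRandomInput P ν ξ) (tie : ℕ → Finset (Fin K) → Fin K)
    (hint : ∀ i, Integrable (fun y => y) (ν i)) (n : ℕ) :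
    Integrable (fun ω => totalReward tie (fun c => ξ c ω) n) P :=
  integrable_finsetSum _ fun _ ht => h.integrable_roundReward tie hint (Finset.mem_Icc.1 ht).1

/-- The event that arm `i` is pulled in round `t`. -/
def armEvent (ξ : (c : Source K) → Ω → c.Value) (tie : ℕ → Finset (Fin K) → Fin K) (t : ℕ)
    (i : Fin K) : Set Ω :=
  {ω | arm tie (fun c => ξ c ω) t = i}

theorem measurableSet_armEvent (h : IsRandomInput P ν ξ) (tie : ℕ → Finset (Fin K) → Fin K) (t : ℕ)
    (i : Fin K) : MeasurableSet (armEvent ξ tie t i) :=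
  ((measurable_arm tie t).comp h.measurable_pi) (measurableSet_singleton i)

variable [IsProbabilityMeasure P]

theorem integral_roundReward (h : IsRandomInput P ν ξ) (tie : ℕ → Finset (Fin K) → Fin K)
    (hint : ∀ i, Integrable (fun y => y) (ν i)) {t : ℕ} (ht : 1 ≤ t) :
    ∫ ω, roundReward tie (fun c => ξ c ω) t ∂P = ∑ i, P.real (armEvent ξ tie t i) * mean (ν i) := by
  simp only [roundReward_eq tie ht]
  rw [integral_finsetSum _ fun i _ => integrable_finsetSum _ fun s _ =>
    h.integrable_indicator_mul_reward tie (hint i) t s]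
  refine Finset.sum_congr rfl fun i _ => ?_
  rw [integral_finsetSum _ fun s _ => h.integrable_indicator_mul_reward tie (hint i) t s]
  have hset (s : ℕ) : MeasurableSet ((fun ω (c : Source K) => ξ c ω) ⁻¹' pullSet tie t i s) :=
    h.measurable_pi (measurableSet_pullSet tie t i s)
  have hterm (s : ℕ) : ∫ ω, (pullSet tie t i s).indicator (fun _ => (1 : ℝ)) (fun c => ξ c ω) *
      rewardInput ξ i s ω ∂P =
      P.real ((fun ω (c : Source K) => ξ c ω) ⁻¹' pullSet tie t i s) * mean (ν i) := by
    rw [(h.indepFun_pullSet_reward tie t i s).integral_fun_mul_eq_mul_integral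
      ((measurable_const.indicator (measurableSet_pullSet tie t i s)).comp
        h.measurable_pi).aestronglyMeasurable (h.measurable_reward i s).aestronglyMeasurable,
      h.integral_rewardInput, ← integral_indicator_one (hset s)]
    rfl
  simp only [hterm]
  rw [← Finset.sum_mul, ← measureReal_biUnion_finset (fun s _ s' _ hs => ?_) fun s _ => hset s]
  · congr 2
    ext ω
    simp only [Set.mem_iUnion, Set.mem_preimage, pullSet, Set.mem_ofPred_eq, armEvent,
      Finset.mem_range, exists_prop]
    constructor
    · rintro ⟨s, -, h', -⟩
      exact h'
    · intro h'
      refine ⟨_, ?_, h', rfl⟩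
      have := pulls_le (tie := tie) (fun c => ξ c ω) (t - 1) i
      omega
  · exact Set.disjoint_left.2 fun ω h1 h2 => hs (h1.2.symm.trans h2.2)

theorem sum_measureReal_armEvent (h : IsRandomInput P ν ξ) (tie : ℕ → Finset (Fin K) → Fin K)
    (t : ℕ) : ∑ i, P.real (armEvent ξ tie t i) = 1 := by
  rw [← measureReal_biUnion_finset (fun i _ i' _ hi => ?_) fun i _ => h.measurableSet_armEvent tie t i]
  · have : (⋃ i ∈ Finset.univ, armEvent ξ tie t i) = Set.univ := by
      ext ω
      simp [armEvent]
    rw [this]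
    simp
  · exact Set.disjoint_left.2 fun ω h1 h2 => hi (h1.symm.trans h2)

theorem gap_eq {best : Fin K} (hbest : ∀ i, mean (ν i) ≤ mean (ν best)) (i : Fin K) :
    gap ν i = mean (ν best) - mean (ν i) := by
  have : (⨆ j, mean (ν j)) = mean (ν best) :=
    le_antisymm (haveI : Nonempty (Fin K) := ⟨best⟩; ciSup_le hbest)
      (le_ciSup (f := fun j => mean (ν j)) (Set.finite_range _).bddAbove best)
  rw [gap, this]

theorem regret_eq_sum (h : IsRandomInput P ν ξ) (tie : ℕ → Finset (Fin K) → Fin K)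
    (hint : ∀ i, Integrable (fun y => y) (ν i)) (n : ℕ) :
    regret P ν tie ξ n = ∑ i, gap ν i * ∑ t ∈ Finset.Icc 1 n, P.real (armEvent ξ tie t i) := by
  unfold regret totalReward
  rw [integral_finsetSum _ fun t ht => h.integrable_roundReward tie hint (Finset.mem_Icc.1 ht).1,
    Finset.sum_congr rfl fun t ht => h.integral_roundReward tie hint (Finset.mem_Icc.1 ht).1]
  simp only [Finset.mul_sum]
  rw [Finset.sum_comm (s := (Finset.univ : Finset (Fin K)))]
  have : (n : ℝ) * (⨆ j, mean (ν j)) = ∑ t ∈ Finset.Icc 1 n, (⨆ j, mean (ν j)) := by simp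
  rw [this, ← Finset.sum_sub_distrib]
  refine Finset.sum_congr rfl fun t _ => ?_
  simp only [gap, sub_mul, Finset.sum_sub_distrib]
  rw [← Finset.mul_sum, h.sum_measureReal_armEvent, mul_one]
  congr 1
  exact Finset.sum_congr rfl fun i _ => mul_comm _ _

/-- The event that arm `i` is pulled in round `t` after at least `N` pulls. -/
def lateEvent (ξ : (c : Source K) → Ω → c.Value) (tie : ℕ → Finset (Fin K) → Fin K) (t : ℕ)
    (i : Fin K) (N : ℕ) : Set Ω :=
  {ω | arm tie (fun c => ξ c ω) t = i ∧ N ≤ pulls tie (fun c => ξ c ω) (t - 1) i}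

theorem measurableSet_lateEvent (h : IsRandomInput P ν ξ) (tie : ℕ → Finset (Fin K) → Fin K) (t : ℕ)
    (i : Fin K) (N : ℕ) : MeasurableSet (lateEvent ξ tie t i N) :=
  (h.measurableSet_armEvent tie t i).inter
    ((((measurable_pi_apply i).comp (measurable_pulls tie (t - 1))).comp h.measurable_pi)
      measurableSet_Ici)

theorem sum_measureReal_armEvent_le (h : IsRandomInput P ν ξ) (tie : ℕ → Finset (Fin K) → Fin K)
    (n N : ℕ) (i : Fin K) :
    ∑ t ∈ Finset.Icc 1 n, P.real (armEvent ξ tie t i) ≤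
      N + ∑ t ∈ Finset.Icc 1 n, P.real (lateEvent ξ tie t i N) := by
  classical
  have hA (t) := h.measurableSet_armEvent tie t i
  have hB (t) := h.measurableSet_lateEvent tie t i N
  have hiA (t) : Integrable ((armEvent ξ tie t i).indicator (1 : Ω → ℝ)) P :=
    (integrable_const (1 : ℝ)).indicator (hA t)
  have hiB (t) : Integrable ((lateEvent ξ tie t i N).indicator (1 : Ω → ℝ)) P :=
    (integrable_const (1 : ℝ)).indicator (hB t)
  simp only [← integral_indicator_one (hA _), ← integral_indicator_one (hB _)]
  rw [← integral_finsetSum _ fun t _ => hiA t, ← integral_finsetSum _ fun t _ => hiB t]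
  have hN : (N : ℝ) = ∫ _, (N : ℝ) ∂P := by simp
  rw [hN, ← integral_add (integrable_const _) (integrable_finsetSum _ fun t _ => hiB t)]
  refine integral_mono (integrable_finsetSum _ fun t _ => hiA t)
    ((integrable_const _).add (integrable_finsetSum _ fun t _ => hiB t)) fun ω => ?_
  have := pulls_le_add_sum (tie := tie) (fun c => ξ c ω) n N i
  rw [pulls_eq_sum] at this
  have h2 : ((∑ t ∈ Finset.Icc 1 n, if arm tie (fun c => ξ c ω) t = i then 1 else 0 : ℕ) : ℝ) ≤
      N + ((∑ t ∈ Finset.Icc 1 n, if arm tie (fun c => ξ c ω) t = i ∧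
        N ≤ pulls tie (fun c => ξ c ω) (t - 1) i then 1 else 0 : ℕ) : ℝ) := by exact_mod_cast this
  push_cast at h2
  have e1 (t) : (armEvent ξ tie t i).indicator (1 : Ω → ℝ) ω =
      if arm tie (fun c => ξ c ω) t = i then 1 else 0 := by
    simp only [Set.indicator, armEvent, Set.mem_ofPred_eq, Pi.one_apply]
    congr
  have e2 (t) : (lateEvent ξ tie t i N).indicator (1 : Ω → ℝ) ω =
      if arm tie (fun c => ξ c ω) t = i ∧ N ≤ pulls tie (fun c => ξ c ω) (t - 1) i then 1 else 0 := by
    simp only [Set.indicator, lateEvent, Set.mem_ofPred_eq, Pi.one_apply]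
    congr
  simp only [e1, e2]
  exact h2

end IsRandomInput

/-! ### The expected number of pulls of a suboptimal arm -/

theorem mul_log_sq_le_levelDen (t : ℕ) : (t : ℝ) * Real.log t ^ 2 ≤ levelDen t :=
  le_trans (by linarith) (Nat.le_ceil _)

/-- A crude bound suffices: the union over all copies costs a factor `t⁴` against the failure
probability `t⁻⁸`. -/
theorem levelDen_le {t : ℕ} (ht : 3 ≤ t) : (levelDen t : ℝ) ≤ (t : ℝ) ^ 4 := by
  have ht' : (3 : ℝ) ≤ t := by exact_mod_cast ht
  have h1 : (levelDen t : ℝ) < 1 + (t : ℝ) * Real.log t ^ 2 + 1 := Nat.ceil_lt_add_one (by positivity)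
  have h2 : Real.log t ≤ t := (Real.log_le_sub_one_of_pos (by linarith)).trans (by linarith)
  have h3 : 0 ≤ Real.log t := Real.log_nonneg (by linarith)
  have h4 : Real.log t ^ 2 ≤ (t : ℝ) ^ 2 := pow_le_pow_left₀ h3 h2 2
  have h5 : (t : ℝ) * Real.log t ^ 2 ≤ (t : ℝ) ^ 3 := by
    calc (t : ℝ) * Real.log t ^ 2 ≤ t * (t : ℝ) ^ 2 := by gcongr
      _ = (t : ℝ) ^ 3 := by ring
  have h6 : (3 : ℝ) * t ^ 3 ≤ (t : ℝ) ^ 4 := by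
    calc (3 : ℝ) * t ^ 3 ≤ t * t ^ 3 := by gcongr
      _ = (t : ℝ) ^ 4 := by ring
  have h7 : (1 : ℝ) ≤ (t : ℝ) ^ 3 := one_le_pow₀ (by linarith)
  linarith

/-- A round from which on the concentration bounds hold for the moment order `1 + a`. -/
noncomputable def startRound (a : ℝ) : ℕ :=
  open Classical in
  if h : 0 < a ∧ a ≤ 1 then (eventually_atTop.1 (eventually_blocks_suffice h.1 h.2)).choose else 0

theorem blocks_suffice {a : ℝ} (ha0 : 0 < a) (ha1 : a ≤ 1) {t : ℕ} (ht : startRound a ≤ t)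
    {s : ℕ} {Δ M : ℝ} (hΔ : 0 < Δ) (hM : 0 ≤ M)
    (hs : sizeConst a (M / Δ ^ (1 + a)) * Real.log t ^ 2 / 4 ≤ s) :
    numBlocks t s ≤ s ∧
      (∀ B : ℕ, s / numBlocks t s ≤ B →
        2 * M / ((Δ / 16) ^ (1 + a) * (B : ℝ) ^ a) + 8 / B ≤ Real.exp (-2) / 4) ∧
      Real.exp (-(numBlocks t s : ℝ)) ≤ 1 / (t : ℝ) ^ 8 := by
  rw [startRound, dif_pos ⟨ha0, ha1⟩] at ht
  exact (eventually_atTop.1 (eventually_blocks_suffice ha0 ha1)).choose_spec t ht s Δ M hΔ hM hs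

/-- The rate `roundConst / t` bounds the probability that a suboptimal arm is pulled late. -/
noncomputable def roundConst (a ρ : ℝ) : ℝ := sizeConst a ρ / 4 + 4

/-- The constant of the regret bound. -/
noncomputable def regretConst (a a' ρ : ℝ) : ℝ :=
  5 + startRound a + startRound a' + roundConst a ρ + roundConst a ρ ^ 2

namespace IsRandomInput

variable {Ω : Type*} [MeasurableSpace Ω] {P : Measure Ω} {K : ℕ} {ν : Fin K → Measure ℝ}
  {ξ : (c : Source K) → Ω → c.Value} [IsProbabilityMeasure P] {a : Fin K → ℝ} {best i : Fin K}
  {tie : ℕ → Finset (Fin K) → Fin K}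

theorem absMoment_nonneg (ν : Measure ℝ) (a : ℝ) : 0 ≤ absMoment ν a :=
  integral_nonneg fun y => by positivity

/-- The levels `μ_i + Δ/2` and `μ_* - Δ/2` coincide. If the best arm's bound reaches it, so does
that of the arm pulled instead. The unions over `s` remove the random pull counts. -/
theorem lateEvent_subset (htie : ∀ t S, S.Nonempty → tie t S ∈ S)
    (hbest : ∀ i, mean (ν i) ≤ mean (ν best)) {t N : ℕ} (ht : 1 ≤ t) (hN : 1 ≤ N) :
    lateEvent ξ tie t i N ⊆
      (⋃ s ∈ Finset.Icc N t, {ω | ((mean (ν i) + gap ν i / 2 : ℝ) : EReal) ≤ ucbInput ξ t i s ω}) ∪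
      ⋃ s ∈ Finset.range t, {ω | ucbInput ξ t best s ω < ((mean (ν best) - gap ν i / 2 : ℝ) : EReal)} := by
  rintro ω ⟨harm, hpulls⟩
  set x : (c : Source K) → c.Value := fun c => ξ c ω
  have hKt : K < t := lt_of_arm_eq x ht harm (hN.trans hpulls)
  have hle : ∀ j, pulls tie x (t - 1) j ≤ t - 1 := fun j => pulls_le x (t - 1) j
  have hucb := armUCB_le_of_arm_eq htie x hKt harm best
  by_cases hlow : armUCB x t best (pulls tie x (t - 1) best) <
      ((mean (ν best) - gap ν i / 2 : ℝ) : EReal)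
  · right
    refine Set.mem_iUnion₂.2 ⟨pulls tie x (t - 1) best, ?_, hlow⟩
    have := hle best
    exact Finset.mem_range.2 (by omega)
  · left
    refine Set.mem_iUnion₂.2 ⟨pulls tie x (t - 1) i, ?_, ?_⟩
    · have := hle i
      exact Finset.mem_Icc.2 ⟨hpulls, by omega⟩
    · have heq : mean (ν best) - gap ν i / 2 = mean (ν i) + gap ν i / 2 := by
        rw [gap_eq hbest]; ring
      rw [heq] at hlow
      exact (not_lt.1 hlow).trans hucb

theorem card_filter_lt_le (t : ℕ) {A : ℝ} (hA : 0 ≤ A) :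
    (((Finset.range t).filter fun s : ℕ => (s : ℝ) < A).card : ℝ) ≤ A + 1 := by
  have hsub : ((Finset.range t).filter fun s : ℕ => (s : ℝ) < A) ⊆ Finset.range ⌈A⌉₊ := fun s hs =>
    Finset.mem_range.2 (Nat.lt_ceil.2 (Finset.mem_filter.1 hs).2)
  have h1 := Finset.card_le_card hsub
  rw [Finset.card_range] at h1
  exact (by exact_mod_cast h1 : (_ : ℝ) ≤ (⌈A⌉₊ : ℝ)).trans (Nat.ceil_lt_add_one hA).le

theorem measureReal_lateEvent_le (h : IsRandomInput P ν ξ) (hν : ∀ i, IsProbabilityMeasure (ν i))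
    (hsymm : ∀ i, SymmetricAbout (ν i) (mean (ν i))) (ha : ∀ i, 0 < a i ∧ a i ≤ 1)
    (hint : ∀ i, FiniteAbsMoment (ν i) (a i)) (htie : ∀ t S, S.Nonempty → tie t S ∈ S)
    (hbest : ∀ i, mean (ν i) ≤ mean (ν best)) (hgap : 0 < gap ν i) {t N : ℕ} (ht3 : 3 ≤ t)
    (ht1 : startRound (a best) ≤ t) (ht2 : startRound (a i) ≤ t) (hN : 1 ≤ N)
    (hNs : sizeConst (a i) (absMoment (ν i) (a i) / gap ν i ^ (1 + a i)) * Real.log t ^ 2 / 4 ≤ N) :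
    P.real (lateEvent ξ tie t i N) ≤
      roundConst (a best) (absMoment (ν best) (a best) / gap ν i ^ (1 + a best)) / t := by
  set D := sizeConst (a best) (absMoment (ν best) (a best) / gap ν i ^ (1 + a best))
  have hD : 289 ≤ D := sizeConst_ge _ _
  have ht0 : (3 : ℝ) ≤ t := by exact_mod_cast ht3
  have htpos : (0 : ℝ) < t := by linarith
  have hlog1 : 1 ≤ Real.log t := by
    rw [Real.le_log_iff_exp_le htpos]
    exact (Real.exp_one_lt_d9.le.trans (by norm_num)).trans ht0
  have hlogsq : 1 ≤ Real.log t ^ 2 := one_le_pow₀ hlog1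
  have hm0 : (0 : ℝ) < t * Real.log t ^ 2 := by positivity
  have hm1 := mul_log_sq_le_levelDen t
  have hm2 : 2 ≤ levelDen t := by
    have : (2 : ℝ) ≤ levelDen t := by nlinarith
    exact_mod_cast this
  have hm4 := levelDen_le ht3
  have hupper : ∀ s ∈ Finset.Icc N t,
      P.real {ω | ((mean (ν i) + gap ν i / 2 : ℝ) : EReal) ≤ ucbInput ξ t i s ω} ≤
        1 / (t : ℝ) ^ 4 := by
    intro s hs
    have hs' : (N : ℝ) ≤ s := by exact_mod_cast (Finset.mem_Icc.1 hs).1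
    obtain ⟨h1, h2, h3⟩ := blocks_suffice (ha i).1 (ha i).2 ht2 hgap (absMoment_nonneg _ _)
      (hNs.trans hs')
    refine (h.measureReal_mean_add_le_ucb (hsymm i) (ha i).1 (ha i).2 (hint i) hgap h1 h2 h3).trans ?_
    calc (levelDen t : ℝ) * (1 / (t : ℝ) ^ 8) ≤ (t : ℝ) ^ 4 * (1 / (t : ℝ) ^ 8) := by gcongr
      _ = 1 / (t : ℝ) ^ 4 := by field_simp
  -- Below the concentration threshold only the exact level is available; above it concentration is
  -- far stronger.
  have hlower : ∀ s ∈ Finset.range t,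
      P.real {ω | ucbInput ξ t best s ω < ((mean (ν best) - gap ν i / 2 : ℝ) : EReal)} ≤
        (if (s : ℝ) < D * Real.log t ^ 2 / 4 then 1 / (levelDen t : ℝ) else 0) +
          2 * (1 / (t : ℝ) ^ 8) := by
    intro s _
    split_ifs with hs
    · refine le_trans (le_trans (measureReal_mono fun ω hω => ?_)
        (h.measureReal_ucb_lt_mean (hsymm best) t s)) (le_add_of_nonneg_right (by positivity))
      exact lt_of_lt_of_le hω (EReal.coe_le_coe_iff.2 (by linarith))
    · obtain ⟨h1, h2, h3⟩ := blocks_suffice (ha best).1 (ha best).2 ht1 hgap (absMoment_nonneg _ _)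
        (not_lt.1 hs)
      rw [zero_add]
      exact h.measureReal_ucb_lt_mean_sub (hsymm best) (ha best).1 (ha best).2 (hint best) hgap hm2
        h1 h2 h3
  have hA0 : 0 ≤ D * Real.log t ^ 2 / 4 := by positivity
  calc P.real (lateEvent ξ tie t i N)
      ≤ ∑ s ∈ Finset.Icc N t, 1 / (t : ℝ) ^ 4 + ∑ s ∈ Finset.range t,
          ((if (s : ℝ) < D * Real.log t ^ 2 / 4 then 1 / (levelDen t : ℝ) else 0) +
            2 * (1 / (t : ℝ) ^ 8)) :=
        (measureReal_mono (lateEvent_subset htie hbest (by omega) hN)).trans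
          ((measureReal_union_le _ _).trans (add_le_add
            ((measureReal_biUnion_finset_le _ _).trans (Finset.sum_le_sum hupper))
            ((measureReal_biUnion_finset_le _ _).trans (Finset.sum_le_sum hlower))))
    _ ≤ t * (1 / (t : ℝ) ^ 4) + ((D / 4 + 1) / t + t * (2 * (1 / (t : ℝ) ^ 8))) := by
        refine add_le_add ?_ ?_
        · rw [Finset.sum_const, nsmul_eq_mul, Nat.card_Icc]
          -- Here `N ≥ 1` is used: at most `t` counts occur.
          have : ((t + 1 - N : ℕ) : ℝ) ≤ t := by exact_mod_cast (by omega : t + 1 - N ≤ t)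
          gcongr
        · rw [Finset.sum_add_distrib, Finset.sum_const, nsmul_eq_mul, Finset.card_range,
            ← Finset.sum_filter, Finset.sum_const, nsmul_eq_mul]
          refine add_le_add_left ?_ _
          -- The number of small counts is of order `log² t`, which the factor `log² t` in `levelDen
          -- t` cancels exactly, leaving the rate `1/t`.
          calc _ ≤ (D * Real.log t ^ 2 / 4 + 1) * (1 / (t * Real.log t ^ 2)) := by
                refine mul_le_mul (card_filter_lt_le t hA0) ?_ (by positivity) (by positivity)
                exact one_div_le_one_div_of_le hm0 hm1
            _ ≤ ((D / 4 + 1) * Real.log t ^ 2) * (1 / (t * Real.log t ^ 2)) := by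
                refine mul_le_mul_of_nonneg_right ?_ (by positivity)
                nlinarith
            _ = (D / 4 + 1) / t := by field_simp
    _ ≤ roundConst (a best) (absMoment (ν best) (a best) / gap ν i ^ (1 + a best)) / t := by
        have e1 : (t : ℝ) * (1 / (t : ℝ) ^ 4) ≤ 1 / t := by
          rw [mul_one_div, div_le_div_iff₀ (by positivity) htpos]
          nlinarith [pow_pos htpos 2, pow_pos htpos 3, pow_pos htpos 4]
        have e2 : (t : ℝ) * (2 * (1 / (t : ℝ) ^ 8)) ≤ 2 / t := by
          have h7 : (t : ℝ) ≤ (t : ℝ) ^ 7 := le_self_pow₀ (by linarith) (by norm_num)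
          calc (t : ℝ) * (2 * (1 / (t : ℝ) ^ 8)) = 2 / (t : ℝ) ^ 7 := by field_simp
            _ ≤ 2 / (t : ℝ) := by gcongr
        have e3 : roundConst (a best) (absMoment (ν best) (a best) / gap ν i ^ (1 + a best)) / t =
            (D / 4 + 1) / t + 1 / t + 2 / t := by
          simp only [roundConst, D]; field_simp; ring
        linarith

theorem sum_measureReal_armEvent_le_regretConst (h : IsRandomInput P ν ξ)
    (hν : ∀ i, IsProbabilityMeasure (ν i))
    (hsymm : ∀ i, SymmetricAbout (ν i) (mean (ν i))) (ha : ∀ i, 0 < a i ∧ a i ≤ 1)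
    (hint : ∀ i, FiniteAbsMoment (ν i) (a i)) (htie : ∀ t S, S.Nonempty → tie t S ∈ S)
    (hbest : ∀ i, mean (ν i) ≤ mean (ν best)) (hgap : 0 < gap ν i) {n : ℕ} (hn : 1 ≤ n) :
    ∑ t ∈ Finset.Icc 1 n, P.real (armEvent ξ tie t i) ≤
      sizeConst (a i) (absMoment (ν i) (a i) / gap ν i ^ (1 + a i)) * Real.log n ^ 2 +
        regretConst (a best) (a i) (absMoment (ν best) (a best) / gap ν i ^ (1 + a best)) := by
  set D := sizeConst (a i) (absMoment (ν i) (a i) / gap ν i ^ (1 + a i))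
  set G := roundConst (a best) (absMoment (ν best) (a best) / gap ν i ^ (1 + a best)) with hGdef
  have hD : 289 ≤ D := sizeConst_ge _ _
  have hG : 0 ≤ G := by
    have := sizeConst_ge (a best) (absMoment (ν best) (a best) / gap ν i ^ (1 + a best))
    simp only [G, roundConst]
    linarith
  -- A quarter of `D log² n` suffices for concentration in every round up to `n`; the rest is kept
  -- in reserve. The `+ 1` puts late pulls after the initialization.
  set N := ⌈D * Real.log n ^ 2 / 4⌉₊ + 1
  have hN : (N : ℝ) ≤ D * Real.log n ^ 2 / 4 + 2 := by
    have := Nat.ceil_lt_add_one (show 0 ≤ D * Real.log n ^ 2 / 4 by positivity)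
    simp only [N]
    push_cast
    linarith
  -- Rounds before `T` are bounded trivially by probability `1`.
  set T := 3 + startRound (a best) + startRound (a i) with hT
  have hlate : ∀ t ∈ Finset.Icc 1 n, P.real (lateEvent ξ tie t i N) ≤
      (if t < T then 1 else 0) + G * (t : ℝ)⁻¹ := by
    intro t ht
    rw [Finset.mem_Icc] at ht
    split_ifs with htT
    · exact measureReal_le_one.trans (le_add_of_nonneg_right (by positivity))
    · rw [zero_add, ← div_eq_mul_inv]
      refine h.measureReal_lateEvent_le hν hsymm ha hint htie hbest hgap (by omega) (by omega)
        (by omega) (by omega) ?_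
      have h1 : Real.log t ^ 2 ≤ Real.log n ^ 2 := by
        have ht1 : (1 : ℝ) ≤ t := by exact_mod_cast ht.1
        have htn : (t : ℝ) ≤ n := by exact_mod_cast ht.2
        exact pow_le_pow_left₀ (Real.log_nonneg ht1) (Real.log_le_log (by linarith) htn) 2
      have h2 : D * Real.log n ^ 2 / 4 ≤ N := by
        have := Nat.le_ceil (D * Real.log n ^ 2 / 4)
        simp only [N]
        push_cast
        linarith
      refine le_trans ?_ h2
      gcongr
  have hharm : ∑ t ∈ Finset.Icc 1 n, (t : ℝ)⁻¹ ≤ 1 + Real.log n := by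
    have := harmonic_le_one_add_log n
    rw [harmonic_eq_sum_Icc] at this
    push_cast at this
    exact this
  have hfew : ∑ t ∈ Finset.Icc 1 n, (if t < T then (1 : ℝ) else 0) ≤ T := by
    rw [← Finset.sum_filter, Finset.sum_const, nsmul_eq_mul, mul_one]
    have hsub : (Finset.Icc 1 n).filter (fun t => t < T) ⊆ Finset.range T := fun t ht =>
      Finset.mem_range.2 (Finset.mem_filter.1 ht).2
    have := Finset.card_le_card hsub
    rw [Finset.card_range] at this
    exact_mod_cast this
  have hlog0 : 0 ≤ Real.log n := Real.log_nonneg (by exact_mod_cast hn)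
  have hTr : (T : ℝ) = 3 + startRound (a best) + startRound (a i) := by rw [hT]; push_cast; ring
  calc ∑ t ∈ Finset.Icc 1 n, P.real (armEvent ξ tie t i)
      ≤ N + ∑ t ∈ Finset.Icc 1 n, ((if t < T then 1 else 0) + G * (t : ℝ)⁻¹) :=
        (h.sum_measureReal_armEvent_le tie n N i).trans
          (add_le_add le_rfl (Finset.sum_le_sum hlate))
    _ ≤ (D * Real.log n ^ 2 / 4 + 2) + (T + G * (1 + Real.log n)) := by
        rw [Finset.sum_add_distrib, ← Finset.mul_sum]
        gcongr
    _ ≤ D * Real.log n ^ 2 +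
        regretConst (a best) (a i) (absMoment (ν best) (a best) / gap ν i ^ (1 + a best)) := by
        rw [regretConst, ← hGdef, hTr]
        -- The harmonic term obeys `G log n ≤ (G² + log² n)/2`; the reserve `3D/4 · log² n` absorbs
        -- the second half, and `G²` goes into `regretConst`.
        nlinarith [sq_nonneg (G - Real.log n), sq_nonneg (Real.log n),
          mul_nonneg (sub_nonneg.2 hD) (sq_nonneg (Real.log n))]

end IsRandomInput

/-! ### Regret bounds -/

namespace IsRandomInput

variable {Ω : Type*} [MeasurableSpace Ω] {P : Measure Ω} {K : ℕ} {ν : Fin K → Measure ℝ}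
  {ξ : (c : Source K) → Ω → c.Value} [IsProbabilityMeasure P] {a : Fin K → ℝ} {best : Fin K}
  {tie : ℕ → Finset (Fin K) → Fin K}

theorem regret_le (h : IsRandomInput P ν ξ) (hν : ∀ i, IsProbabilityMeasure (ν i))
    (hsymm : ∀ i, SymmetricAbout (ν i) (mean (ν i))) (ha : ∀ i, 0 < a i ∧ a i ≤ 1)
    (hint : ∀ i, FiniteAbsMoment (ν i) (a i)) (htie : ∀ t S, S.Nonempty → tie t S ∈ S)
    (hbest : ∀ i, mean (ν i) ≤ mean (ν best)) {n : ℕ} (hn : 1 ≤ n) :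
    regret P ν tie ξ n ≤ ∑ i with 0 < gap ν i,
      (sizeConst (a i) (absMoment (ν i) (a i) / gap ν i ^ (1 + a i)) * Real.log n ^ 2 +
        regretConst (a best) (a i) (absMoment (ν best) (a best) / gap ν i ^ (1 + a best))) *
        gap ν i := by
  rw [h.regret_eq_sum tie fun i => integrable_id_of_finiteAbsMoment (ha i).1 (hint i),
    Finset.sum_filter]
  refine Finset.sum_le_sum fun i _ => ?_
  split_ifs with hi
  · rw [mul_comm]
    exact mul_le_mul_of_nonneg_right
      (h.sum_measureReal_armEvent_le_regretConst hν hsymm ha hint htie hbest hi hn) hi.le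
  -- Arms with zero gap contribute nothing.
  · have : gap ν i = 0 := le_antisymm (not_lt.1 hi) (by rw [gap_eq hbest]; linarith [hbest i])
    simp [this]

end IsRandomInput

theorem eventually_log_sq_le_rpow (A B : ℝ) {r C : ℝ} (hr : 0 < r) (hC : 0 < C) :
    ∀ᶠ n : ℕ in atTop, A * Real.log n ^ 2 + B ≤ (n : ℝ) ^ r * C := by
  have h1 : (fun x : ℝ => Real.log x ^ (2 : ℝ)) =o[atTop] fun x => x ^ r :=
    isLittleO_log_rpow_rpow_atTop 2 hr
  have h2 : (fun _ : ℝ => (1 : ℝ)) =o[atTop] fun x : ℝ => x ^ r :=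
    Asymptotics.isLittleO_const_left.2 (Or.inr
      (tendsto_norm_atTop_atTop.comp (tendsto_rpow_atTop hr)))
  have h3 := ((h1.const_mul_left A).add (h2.const_mul_left B)).bound hC
  filter_upwards [tendsto_natCast_atTop_atTop.eventually h3] with n hn
  have hpos : 0 ≤ (n : ℝ) ^ r := by positivity
  rw [Real.norm_eq_abs, Real.norm_of_nonneg hpos, mul_one, Real.rpow_two] at hn
  exact (le_abs_self _).trans (hn.trans (le_of_eq (mul_comm _ _)))

theorem one_le_mul_log_cubed_rpow {K n : ℕ} {a : ℝ} (hK : 1 ≤ K) (ha : 0 < a) (hn : 3 ≤ n) :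
    1 ≤ (K * (2 * momentConst a * Real.log n ^ 3)) ^ (a / (1 + a)) := by
  have hn' : (3 : ℝ) ≤ n := by exact_mod_cast hn
  have hlog : 1 ≤ Real.log n := by
    rw [Real.le_log_iff_exp_le (by linarith)]
    exact (Real.exp_one_lt_d9.le.trans (by norm_num)).trans hn'
  refine Real.one_le_rpow ?_ (by positivity)
  refine one_le_mul_of_one_le_of_one_le (by exact_mod_cast hK) ?_
  exact one_le_mul_of_one_le_of_one_le (by linarith [one_le_momentConst ha]) (one_le_pow₀ hlog)

end RMMUCB

theorem mainTheorem1 :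
    ∃ C : ℝ → ℝ → ℝ → ℝ,
      ∀ (K : ℕ) (ν : Fin K → Measure ℝ) (a : Fin K → ℝ) (best : Fin K)
        (tie : ℕ → Finset (Fin K) → Fin K)
        (Ω : Type*) [MeasurableSpace Ω] (P : Measure Ω) [IsProbabilityMeasure P]
        (ξ : (c : RMMUCB.Source K) → Ω → c.Value),
        (∀ i, IsProbabilityMeasure (ν i)) →
        (∀ i, RMMUCB.SymmetricAbout (ν i) (RMMUCB.mean (ν i))) →
        (∀ i, 0 < a i ∧ a i ≤ 1) →
        (∀ i, RMMUCB.FiniteAbsMoment (ν i) (a i)) →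
        (∀ i, RMMUCB.mean (ν i) ≤ RMMUCB.mean (ν best)) →
        (∀ t S, S.Nonempty → tie t S ∈ S) →
        RMMUCB.IsRandomInput P ν ξ →
        (∀ n : ℕ, Integrable (fun ω => RMMUCB.totalReward tie (fun c => ξ c ω) n) P) ∧
        (∀ n : ℕ, 1 ≤ n →
          RMMUCB.regret P ν tie ξ n ≤
            ∑ i with 0 < RMMUCB.gap ν i,
              (max (RMMUCB.momentConst (a i) *
                      (RMMUCB.absMoment (ν i) (a i) / RMMUCB.gap ν i ^ (1 + a i)) ^ (1 / a i))
                    (17 ^ 2) * Real.log n ^ 2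
                + C (a best) (a i)
                    (RMMUCB.absMoment (ν best) (a best) / RMMUCB.gap ν i ^ (1 + a best)))
              * RMMUCB.gap ν i) ∧
        (∀ a₀ M : ℝ, (∀ i, a i = a₀) → (∀ i, RMMUCB.absMoment (ν i) (a i) = M) → 0 < M →
          ∀ᶠ n : ℕ in atTop,
            RMMUCB.regret P ν tie ξ n ≤
              (n : ℝ) ^ (1 / (1 + a₀)) *
                (K * (2 * RMMUCB.momentConst a₀ * Real.log n ^ 3)) ^ (a₀ / (1 + a₀)) *
                M ^ (1 / (1 + a₀))) := by
  refine ⟨RMMUCB.regretConst, ?_⟩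
  intro K ν a best tie Ω _ P _ ξ hν hsymm ha hint hbest htie h
  have hbound : ∀ n : ℕ, 1 ≤ n → _ := fun n hn => h.regret_le hν hsymm ha hint htie hbest hn
  refine ⟨fun n => h.integrable_totalReward tie
    (fun i => RMMUCB.integrable_id_of_finiteAbsMoment (ha i).1 (hint i)) n, hbound, ?_⟩
  intro a₀ M ha₀ _ hM
  have ha0 : 0 < a₀ := ha₀ best ▸ (ha best).1
  have hMr : 0 < M ^ (1 / (1 + a₀)) := Real.rpow_pos_of_pos hM _
  set A := ∑ i with 0 < RMMUCB.gap ν i,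
    RMMUCB.sizeConst (a i) (RMMUCB.absMoment (ν i) (a i) / RMMUCB.gap ν i ^ (1 + a i)) *
      RMMUCB.gap ν i with hA
  set B := ∑ i with 0 < RMMUCB.gap ν i, RMMUCB.regretConst (a best) (a i)
    (RMMUCB.absMoment (ν best) (a best) / RMMUCB.gap ν i ^ (1 + a best)) * RMMUCB.gap ν i with hB
  -- For the given bandit `A` and `B` are constants, so `A log² n + B` is eventually below
  -- `n^(1/(1+a₀)) M^(1/(1+a₀))`. The remaining factor with `K` and `log³ n` is at least `1`.
  filter_upwards [RMMUCB.eventually_log_sq_le_rpow A B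
    (show 0 < 1 / (1 + a₀) by positivity) hMr, eventually_ge_atTop 3] with n hn hn3
  have hone := RMMUCB.one_le_mul_log_cubed_rpow (show 1 ≤ K from best.pos) ha0 hn3
  calc RMMUCB.regret P ν tie ξ n ≤ A * Real.log n ^ 2 + B := by
        refine (hbound n (by omega)).trans (le_of_eq ?_)
        rw [hA, hB, Finset.sum_mul, ← Finset.sum_add_distrib]
        exact Finset.sum_congr rfl fun i _ => by ring
    _ ≤ (n : ℝ) ^ (1 / (1 + a₀)) * M ^ (1 / (1 + a₀)) := hn
    _ ≤ _ := by
        refine mul_le_mul_of_nonneg_right ?_ hMr.le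
        exact le_mul_of_one_le_right (by positivity) hone
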